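/- **Setting.** A controller meets $N$ environments, each for $T$ time steps. In environment $i$ ($1\le i\le N$), for $1\le t\le T$, $$x_{t+1}^{(i)}=f_0(x_t^{(i)})+B(x_t^{(i)})u_t^{(i)}-Y(x_t^{(i)})\Theta c^{(i)}+w_t^{(i)},\qquad x_1^{(i)}=0,$$ where $x_t^{(i)},w_t^{(i)}\in\mathbb R^n$, $u_t^{(i)}\in\mathbb R^m$, $c^{(i)}\in\mathbb R^h$, $\Theta\in\mathbb R^{\bar p\times h}$, $f_0:\mathbb R^n\to\mathbb R^n$, $B:\mathbb R^n\to\mathbb R^{n\times m}$, and $Y:\mathbb R^n\to\mathbb R^{n\times\bar p}$ is measurable. The average control error is $\mathsf{ACE}=\frac1{TN}\sum_{i=1}^N\sum_{t=1}^T\|x_t^{(i)}\|$. **Assumptions.** (1) $\operatorname{rank}B(x)=n$ for all $x$. (2) $f_0$ is exponentially input-to-state stable with constants $\beta,\gamma\ge0$, $0\le\rho<1$: whenever $x_{k+1}=f_0(x_k)+v_k$ for $1\le k\le t-1$, one has $\|x_t\|\le\beta\rho^{t-1}\|x_1\|+\gamma\sum_{k=1}^{t-1}\rho^{t-1-k}\|v_k\|$.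 (3) $\|\Theta\|_F\le K_\Theta$, $\|Y(x)\|_F\le K_Y$ for all $x$, and almost surely $\|c^{(i)}\|\le K_c$ and $\|w_t^{(i)}\|\le W$ for all $i,t$. (4) $c^{(i)}$ is chosen adaptively, as a function of what happened before environment $i$, and $x_t^{(i)}$ is determined before $w_t^{(i)}$ is revealed; given everything before $w_t^{(i)}$, each component of $w_t^{(i)}$ is conditionally $R$-sub-Gaussian, i.e. $\mathbb E[e^{s w}\mid\text{past}]\le e^{s^2R^2/2}$ for all $s\in\mathbb R$. **Algorithm (OMAC with bilinear model).** At step $t$ of environment $i$ the control is $u_t^{(i)}=B(x_t^{(i)})^\dagger\,Y(x_t^{(i)})\hat\Theta^{(i)}\hat c_t^{(i)}$, with $\dagger$ the Moore–Penrose pseudo-inverse. Put $y_t^{(i)}=f_0(x_t^{(i)})+B(x_t^{(i)})u_t^{(i)}-x_{t+1}^{(i)}$ and $\ell_t^{(i)}(\Theta',c')=\|Y(x_t^{(i)})\Theta'c'-y_t^{(i)}\|^2$. At the end of environment $i$ the controller observes $c^{(i)}$ and, for a fixed $\lambda>0$, performs ridge regression $$\hat\Theta^{(i+1)}=\arg\min_{\Theta'}\Big(\lambda\|\Theta'\|_F^2+\sum_{j=1}^i\sum_{t=1}^T\ell_t^{(j)}(\Theta',c^{(j)})\Big),$$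 starting from a fixed $\hat\Theta^{(1)}$. Inside environment $i$ an online learning algorithm $\mathcal A_2$, with values in a convex set $\mathcal K_2\subseteq\mathbb R^h$ that almost surely contains every $c^{(i)}$, produces $\hat c_1^{(i)}\in\mathcal K_2$ and $\hat c_{t+1}^{(i)}=\mathcal A_2(\hat c_t^{(i)},g_{1:t}^{(i)})\in\mathcal K_2$ from the costs $g_t^{(i)}(c')=\ell_t^{(i)}(\hat\Theta^{(i)},c')$. Its total regret is $N\cdot o(T)$: there is a function $r(T)=o(T)$ such that almost surely $$\sum_{i=1}^N\Big(\sum_{t=1}^Tg_t^{(i)}(\hat c_t^{(i)})-\inf_{c'\in\mathcal K_2}\sum_{t=1}^Tg_t^{(i)}(c')\Big)\le N\,r(T).$$ **Theorem.** Let $Z_t^{(j)}=c^{(j)\top}\otimes Y(x_t^{(j)})\in\mathbb R^{n\times\bar ph}$ and assume environment diversity: almost surely $\lambda_{\min}\big(\sum_{j=1}^i\sum_{t=1}^TZ_t^{(j)\top}Z_t^{(j)}\big)=\Omega(i)$, i.e. this minimum eigenvalue is at least $\kappa i$ for all $i_0\le i\le N$, with constants $\kappa>0$ and $i_0$. Then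 for all $N\ge2$, $T\ge1$ and $\delta\in(0,1)$, with probability at least $1-\delta$, $$\mathsf{ACE}\le\frac{\gamma}{1-\rho}\sqrt{W^2+\frac{o(T)}{T}+O\Big(\frac{\log(NT/\delta)\log N}{N}\Big)}.$$ If the diversity condition is relaxed to $\Omega(\sqrt i)$ (the minimum eigenvalue is at least $\kappa\sqrt i$ for all $i_0\le i\le N$), the same holds with last term $O\big(\log(NT/\delta)/\sqrt N\big)$. The function $o(T)$ and the constants in $O(\cdot)$ depend only on $n,m,\bar p,h,\beta,\gamma,\rho,W,R,K_\Theta,K_c,K_Y,\lambda,\kappa,i_0$, $\hat\Theta^{(1)}$ and $r$; in particular not on $N$, $T$, $\delta$. -/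

import Mathlib

-- Matrix norms below are Frobenius norms.
open scoped Matrix.Norms.Frobenius Kronecker MeasureTheory

namespace OMAC

/-- `ℝᵏ` with the Euclidean norm. -/
abbrev Vec (k : ℕ) : Type := EuclideanSpace ℝ (Fin k)

/-- The real `a × b` matrices. -/
abbrev Mat (a b : ℕ) : Type := Matrix (Fin a) (Fin b) ℝ

/-- Matrix-vector product on Euclidean vectors. -/
def app {a b : ℕ} (A : Mat a b) (v : Vec b) : Vec a :=
  WithLp.toLp 2 (A.mulVec v.ofLp)

/-- The Moore-Penrose pseudo-inverse `A⁺ = Aᵀ (A Aᵀ)⁻¹` of a matrix of full row rank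
(the only matrices to which it is applied: the actuation matrix has full row rank). -/
noncomputable def pinv {a b : ℕ} (A : Mat a b) : Mat b a :=
  A.transpose * (A * A.transpose)⁻¹

/-- The smallest eigenvalue of a real symmetric matrix. -/
noncomputable def minEigenvalue {ι : Type*} [Fintype ι] [DecidableEq ι]
    (A : Matrix ι ι ℝ) : ℝ :=
  sInf (spectrum ℝ A)

/-- Exponential input-to-state stability of `x_{k+1} = f₀(x_k) + v_k`. -/
def IsEISS {n : ℕ} (f₀ : Vec n → Vec n) (β γ ρ : ℝ) : Prop :=
  ∀ (x v : ℕ → Vec n) (t : ℕ), 1 ≤ t →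
    (∀ k ∈ Finset.Icc 1 (t - 1), x (k + 1) = f₀ (x k) + v k) →
    ‖x t‖ ≤ β * ρ ^ (t - 1) * ‖x 1‖
      + γ * ∑ k ∈ Finset.Icc 1 (t - 1), ρ ^ (t - 1 - k) * ‖v k‖

/-- `X` is conditionally `R`-sub-Gaussian given the sub-σ-algebra `m`:
`E[exp(s X) | m] ≤ exp(s² R² / 2)` almost surely, for every real `s`. -/
def IsCondSubGaussian {Ω : Type*} (m : MeasurableSpace Ω) {_m₀ : MeasurableSpace Ω}
    (R : ℝ) (X : Ω → ℝ) (μ : MeasureTheory.Measure Ω) : Prop :=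
  ∀ s : ℝ, MeasureTheory.Integrable (fun ω => Real.exp (s * X ω)) μ ∧
    ∀ᵐ ω ∂μ, (MeasureTheory.condExp m μ (fun ω' => Real.exp (s * X ω'))) ω
      ≤ Real.exp (s ^ 2 * R ^ 2 / 2)

/-- The system `x_{t+1} = f₀(x_t) + B(x_t) u_t - Y(x_t) Θ c + w_t`. -/
structure Plant (n m p h : ℕ) where
  /-- nominal dynamics -/
  f₀ : Vec n → Vec n
  /-- state-dependent actuation matrix -/
  B : Vec n → Mat n m
  /-- known basis -/
  Y : Vec n → Mat n p
  /-- true shared parameter -/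
  Θ : Mat p h

/-- All the quantities occurring along one closed-loop run; `x i t` is the state at
time `t` of environment `i`, and so on (indices start at `1`). -/
structure Traj (n m p h : ℕ) where
  /-- states -/
  x : ℕ → ℕ → Vec n
  /-- controls -/
  u : ℕ → ℕ → Vec m
  /-- disturbances -/
  w : ℕ → ℕ → Vec n
  /-- environmental conditions -/
  c : ℕ → Vec h
  /-- estimates of the shared parameter -/
  Θhat : ℕ → Mat p h
  /-- estimates of the environmental condition -/
  chat : ℕ → ℕ → Vec h

section Path

variable {n m p h : ℕ} (P : Plant n m p h) (τ : Traj n m p h)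

/-- The bilinear model `F(x; Θ', c') = Y(x) Θ' c'`. -/
def Plant.model (x : Vec n) (Θ' : Mat p h) (c' : Vec h) : Vec n :=
  app (P.Y x) (app Θ' c')

/-- The observed measurement `y_t^{(i)} = f₀(x_t) + B(x_t) u_t - x_{t+1}`. -/
def obs (i t : ℕ) : Vec n :=
  P.f₀ (τ.x i t) + app (P.B (τ.x i t)) (τ.u i t) - τ.x i (t + 1)

/-- The observed loss `ℓ_t^{(i)}(Θ', c') = ‖Y(x_t) Θ' c' - y_t‖²`. -/
noncomputable def loss (i t : ℕ) (Θ' : Mat p h) (c' : Vec h) : ℝ :=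
  ‖P.model (τ.x i t) Θ' c' - obs P τ i t‖ ^ 2

/-- The inner cost `g_t^{(i)}(c') = ℓ_t^{(i)}(Θ̂^{(i)}, c')`. -/
noncomputable def innerCost (i t : ℕ) (c' : Vec h) : ℝ :=
  loss P τ i t (τ.Θhat i) c'

/-- The outer cost, with horizon `T` and ridge parameter `lam`:
`G^{(i)}(Θ') = lam ‖Θ'‖_F² + ∑_{j ≤ i} ∑_{t ≤ T} ℓ_t^{(j)}(Θ', c^{(j)})`. -/
noncomputable def outerCost (T : ℕ) (lam : ℝ) (i : ℕ) (Θ' : Mat p h) : ℝ :=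
  lam * ‖Θ'‖ ^ 2
    + ∑ j ∈ Finset.Icc 1 i, ∑ t ∈ Finset.Icc 1 T, loss P τ j t Θ' (τ.c j)

/-- The total regret of the inner adapter against the set `K₂`:
`∑_i (∑_t g_t^{(i)}(ĉ_t^{(i)}) - inf_{c' ∈ K₂} ∑_t g_t^{(i)}(c'))`. -/
noncomputable def innerRegret (K₂ : Set (Vec h)) (N T : ℕ) : ℝ :=
  ∑ i ∈ Finset.Icc 1 N,
    ((∑ t ∈ Finset.Icc 1 T, innerCost P τ i t (τ.chat i t))
      - ⨅ c' : K₂, ∑ t ∈ Finset.Icc 1 T, innerCost P τ i t (c' : Vec h))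

/-- `Z_t^{(j)} = c^{(j)⊤} ⊗ Y(x_t^{(j)})`, a matrix with `n` rows and `p h` columns. -/
def regressor (j t : ℕ) : Matrix (Unit × Fin n) (Fin h × Fin p) ℝ :=
  Matrix.replicateRow Unit (τ.c j).ofLp ⊗ₖ P.Y (τ.x j t)

/-- `∑_{j ≤ i} ∑_{t ≤ T} Z_t^{(j)⊤} Z_t^{(j)}`. -/
def gram (T i : ℕ) : Matrix (Fin h × Fin p) (Fin h × Fin p) ℝ :=
  ∑ j ∈ Finset.Icc 1 i, ∑ t ∈ Finset.Icc 1 T,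
    (regressor P τ j t).transpose * regressor P τ j t

/-- Average control error. -/
noncomputable def ace (N T : ℕ) : ℝ :=
  1 / ((T : ℝ) * N) * ∑ i ∈ Finset.Icc 1 N, ∑ t ∈ Finset.Icc 1 T, ‖τ.x i t‖

/-- Environment diversity `λ_min(∑_{j ≤ i} ∑_t Z_t^{(j)⊤} Z_t^{(j)}) ≥ κ d(i)` for all
`i` from `i₀` on. -/
def IsDiverse (N T : ℕ) (κ : ℝ) (i₀ : ℕ) (d : ℕ → ℝ) : Prop :=
  ∀ i ∈ Finset.Icc 1 N, i₀ ≤ i → κ * d i ≤ minEigenvalue (gram P τ T i)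

/-- `τ` is a run of the algorithm on the plant `P`, over `N` environments of length `T`,
with ridge regression (parameter `lam`, initial estimate `Θ₁`) in the outer loop, and in the
inner loop the update rule `A₂`, which is given the current estimate and the list
`[g_1, …, g_t]` of the inner costs so far, and which stays in `K₂`. -/
structure IsRun (N T : ℕ) (lam : ℝ) (Θ₁ : Mat p h) (K₂ : Set (Vec h))
    (A₂ : Vec h → List (Vec h → ℝ) → Vec h) : Prop where
  start : ∀ i ∈ Finset.Icc 1 N, τ.x i 1 = 0
  dynamics : ∀ i ∈ Finset.Icc 1 N, ∀ t ∈ Finset.Icc 1 T,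
    τ.x i (t + 1) = P.f₀ (τ.x i t) + app (P.B (τ.x i t)) (τ.u i t)
      - P.model (τ.x i t) P.Θ (τ.c i) + τ.w i t
  control : ∀ i ∈ Finset.Icc 1 N, ∀ t ∈ Finset.Icc 1 T,
    τ.u i t = app (pinv (P.B (τ.x i t))) (P.model (τ.x i t) (τ.Θhat i) (τ.chat i t))
  inner_init : ∀ i ∈ Finset.Icc 1 N, τ.chat i 1 ∈ K₂
  inner_step : ∀ i ∈ Finset.Icc 1 N, ∀ t ∈ Finset.Icc 1 T,
    τ.chat i (t + 1)
      = A₂ (τ.chat i t) ((List.range t).map fun s => innerCost P τ i (s + 1))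
  inner_mem : ∀ i ∈ Finset.Icc 1 N, ∀ t ∈ Finset.Icc 1 T, τ.chat i (t + 1) ∈ K₂
  outer_init : τ.Θhat 1 = Θ₁
  outer_step : ∀ i ∈ Finset.Icc 1 N, ∀ Θ' : Mat p h,
    outerCost P τ T lam i (τ.Θhat (i + 1)) ≤ outerCost P τ T lam i Θ'

/-- Standing assumptions on the plant: full actuation, exponential input-to-state
stability, and bounds on the basis and on the true parameter. -/
structure Plant.IsAdmissible (β γ ρ KΘ KY : ℝ) : Prop where
  full_actuation : ∀ x, (P.B x).rank = n
  eiss : IsEISS P.f₀ β γ ρ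
  meas_Y : ∀ a b, Measurable fun x => P.Y x a b
  norm_Y : ∀ x, ‖P.Y x‖ ≤ KY
  norm_Θ : ‖P.Θ‖ ≤ KΘ

end Path

/-- A random run, adapted to a filtration indexed by the number of elapsed time steps:
step `t` of environment `i` begins at time `(i - 1) T + (t - 1)`. The environment `i`
selects `c^{(i)}` from the past only, and the disturbance `w_t^{(i)}`, revealed after the
state `x_t^{(i)}`, has conditionally `R`-sub-Gaussian components and norm at most `W`. -/
structure IsRandomRun {n m p h : ℕ} {Ω : Type*} {m₀ : MeasurableSpace Ω}
    (μ : MeasureTheory.Measure Ω) (ℱ : MeasureTheory.Filtration ℕ m₀)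
    (P : Plant n m p h) (τ : Ω → Traj n m p h) (N T : ℕ) (lam : ℝ) (Θ₁ : Mat p h)
    (K₂ : Set (Vec h)) (A₂ : Vec h → List (Vec h → ℝ) → Vec h)
    (Kc W R : ℝ) : Prop where
  run : ∀ ω, IsRun P (τ ω) N T lam Θ₁ K₂ A₂
  meas_c : ∀ i ∈ Finset.Icc 1 N, Measurable[ℱ ((i - 1) * T)] fun ω => (τ ω).c i
  meas_x : ∀ i ∈ Finset.Icc 1 N, ∀ t ∈ Finset.Icc 1 T,
    Measurable[ℱ ((i - 1) * T + (t - 1))] fun ω => (τ ω).x i t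
  meas_w : ∀ i ∈ Finset.Icc 1 N, ∀ t ∈ Finset.Icc 1 T,
    Measurable[ℱ ((i - 1) * T + t)] fun ω => (τ ω).w i t
  mem_c : ∀ᵐ ω ∂μ, ∀ i ∈ Finset.Icc 1 N, (τ ω).c i ∈ K₂
  norm_c : ∀ᵐ ω ∂μ, ∀ i ∈ Finset.Icc 1 N, ‖(τ ω).c i‖ ≤ Kc
  norm_w : ∀ᵐ ω ∂μ, ∀ i ∈ Finset.Icc 1 N, ∀ t ∈ Finset.Icc 1 T, ‖(τ ω).w i t‖ ≤ W
  subGaussian_w : ∀ i ∈ Finset.Icc 1 N, ∀ t ∈ Finset.Icc 1 T, ∀ k : Fin n,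
    IsCondSubGaussian (ℱ ((i - 1) * T + (t - 1))) R (fun ω => (τ ω).w i t k) μ

end OMAC

/-! Since `B` has full row rank, the control acts exactly as prescribed and the closed loop reads
`x_{t+1} = f₀(x_t) + v_t`, where `‖v_t‖²` is the inner cost at `ĉ_t`. Input-to-state stability and
Cauchy-Schwarz bound the average control error by `γ / (1 - ρ)` times the root of the average inner
cost (`IsRun.ace_le_sqrt`). The regret bound replaces `ĉ_t` by the true `c` (`sum_innerCost_le`).
There the cost is `‖a + w‖²` with `a = Y (Θ̂ - Θ) c`: it splits into `‖w‖² ≤ W²`, a cross term, and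
`‖a‖²`, at most a constant times `‖Θ̂ - Θ‖²`.

Cross term and ridge error rest on one estimate: for predictable `a` and centred noise bounded by
`W`, `exp ∑ (⟨a, w⟩ - W² ‖a‖²)` has expectation at most one (`integral_exp_expProcess_le_one`), so
the sum exceeds `L` with probability at most `exp (-L)`. In the cross term the estimate depends on
the past only and this applies directly. In the ridge analysis the direction `Θ̂ - Θ` depends on the
very noise it is tested against; a union bound over a grid of deterministic directions, of size
polynomial in `N T`, costs only `log (N T / δ)`. Minimality of the ridge cost then bounds the energy
of the error by that logarithm (`IsRun.ridge_error_le`), diversity divides it by `i` or `√i`, and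
summing over environments gives `log N` or `√N`. -/

namespace OMAC

open Matrix

/-! ### Norm inequalities, the pseudo-inverse and the smallest eigenvalue. -/

section LinearAlgebra

theorem norm_sq_eq_sum {k : ℕ} (v : Vec k) : ‖v‖ ^ 2 = ∑ j, v j ^ 2 := by
  rw [EuclideanSpace.norm_sq_eq]; simp

theorem frobenius_norm_sq {a b : ℕ} (A : Mat a b) : ‖A‖ ^ 2 = ∑ i, ∑ j, A i j ^ 2 := by
  rw [Matrix.frobenius_norm_def, ← Real.sqrt_eq_rpow, Real.sq_sqrt (by positivity)]
  simp

theorem norm_app_le {a b : ℕ} (A : Mat a b) (v : Vec b) : ‖app A v‖ ≤ ‖A‖ * ‖v‖ := by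
  refine le_of_sq_le_sq ?_ (by positivity)
  rw [mul_pow, norm_sq_eq_sum, frobenius_norm_sq, norm_sq_eq_sum, Finset.sum_mul]
  exact Finset.sum_le_sum fun i _ =>
    Finset.sum_mul_sq_le_sq_mul_sq Finset.univ (fun j => A i j) (fun j => v j)

theorem abs_entry_le_norm {a b : ℕ} (A : Mat a b) (i : Fin a) (j : Fin b) : |A i j| ≤ ‖A‖ := by
  refine abs_le_of_sq_le_sq ?_ (norm_nonneg _)
  rw [frobenius_norm_sq]
  calc A i j ^ 2 ≤ ∑ j, A i j ^ 2 :=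
        Finset.single_le_sum (f := fun j => A i j ^ 2) (fun _ _ => sq_nonneg _)
          (Finset.mem_univ j)
    _ ≤ _ := Finset.single_le_sum (f := fun i => ∑ j, A i j ^ 2)
          (fun _ _ => by positivity) (Finset.mem_univ i)

theorem norm_sq_le_of_entries {a b : ℕ} (A : Mat a b) (ε : ℝ) (hA : ∀ i j, |A i j| ≤ ε) :
    ‖A‖ ^ 2 ≤ a * b * ε ^ 2 := by
  rw [frobenius_norm_sq]
  calc ∑ i, ∑ j, A i j ^ 2 ≤ ∑ _i : Fin a, ∑ _j : Fin b, ε ^ 2 :=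
        Finset.sum_le_sum fun i _ => Finset.sum_le_sum fun j _ => by
          rw [← sq_abs]; exact pow_le_pow_left₀ (abs_nonneg _) (hA i j) 2
    _ = a * b * ε ^ 2 := by simp [mul_assoc]

theorem app_app_pinv {a b : ℕ} (A : Mat a b) (hA : A.rank = a) (v : Vec a) :
    app A (app (pinv A) v) = v := by
  have hu : IsUnit (A * A.transpose) := by
    rw [← Matrix.mulVec_surjective_iff_isUnit]
    have h1 : (A * A.transpose).rank = a := by rw [Matrix.rank_self_mul_transpose, hA]
    have h2 : LinearMap.range (A * A.transpose).mulVecLin = ⊤ := by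
      apply Submodule.eq_top_of_finrank_eq
      rw [Module.finrank_fin_fun]; exact h1
    exact LinearMap.range_eq_top.1 h2
  have hm : A * pinv A = 1 := by
    rw [pinv, ← Matrix.mul_assoc]
    exact Matrix.mul_nonsing_inv _ ((Matrix.isUnit_iff_isUnit_det _).1 hu)
  simp only [app, Matrix.mulVec_mulVec, hm, Matrix.one_mulVec]

/-- Subtracting the smallest eigenvalue times the identity shifts the spectrum to the nonnegative
half-line, so the difference is positive semidefinite. -/
theorem minEigenvalue_mul_le {ι : Type*} [Fintype ι] [DecidableEq ι] {A : Matrix ι ι ℝ}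
    (hA : A.IsHermitian) (v : ι → ℝ) :
    minEigenvalue A * (v ⬝ᵥ v) ≤ v ⬝ᵥ A *ᵥ v := by
  have hpsd : (A - (algebraMap ℝ (Matrix ι ι ℝ)) (minEigenvalue A)).PosSemidef := by
    rw [Matrix.posSemidef_iff_isHermitian_and_spectrum_nonneg]
    refine ⟨hA.sub ?_, ?_⟩
    · rw [Matrix.algebraMap_eq_diagonal]
      exact Matrix.isHermitian_diagonal _
    · rw [sub_eq_add_neg, ← map_neg, ← spectrum.add_singleton_eq]
      rintro x ⟨y, hy, z, hz, rfl⟩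
      have : minEigenvalue A ≤ y := csInf_le (Matrix.finite_real_spectrum.bddBelow) hy
      simp only [Set.mem_singleton_iff] at hz
      subst hz
      simpa using this
  have h := hpsd.dotProduct_mulVec_nonneg v
  rw [Matrix.sub_mulVec, dotProduct_sub, Matrix.algebraMap_eq_diagonal] at h
  have e : (Matrix.diagonal ((algebraMap ℝ (ι → ℝ)) (minEigenvalue A))) *ᵥ v
      = minEigenvalue A • v := by
    ext i; simp [Matrix.mulVec_diagonal]
  rw [e, dotProduct_smul, smul_eq_mul] at h
  simpa using h

end LinearAlgebra

/-! ### The bilinear model as a linear map of the vectorised parameter. -/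

section Regressor

variable {n m p h : ℕ} (P : Plant n m p h) (τ : Traj n m p h)

theorem Plant.model_apply (x : Vec n) (X : Mat p h) (c : Vec h) (i : Fin n) :
    P.model x X c i = ∑ a, P.Y x i a * ∑ k, X a k * c k := rfl

theorem Plant.model_sub (x : Vec n) (X X' : Mat p h) (c : Vec h) :
    P.model x (X - X') c = P.model x X c - P.model x X' c := by
  ext i
  simp [Plant.model_apply, sub_mul, mul_sub, Finset.sum_sub_distrib]

theorem Plant.model_add (x : Vec n) (X X' : Mat p h) (c : Vec h) :
    P.model x (X + X') c = P.model x X c + P.model x X' c := by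
  ext i
  simp [Plant.model_apply, add_mul, mul_add, Finset.sum_add_distrib]

theorem Plant.norm_model_le {KY Kc : ℝ} (hY : ∀ x, ‖P.Y x‖ ≤ KY) (x : Vec n) (X : Mat p h)
    {c : Vec h} (hc : ‖c‖ ≤ Kc) : ‖P.model x X c‖ ≤ KY * Kc * ‖X‖ := by
  have hKY : 0 ≤ KY := (norm_nonneg _).trans (hY x)
  calc ‖P.model x X c‖ ≤ ‖P.Y x‖ * ‖app X c‖ := norm_app_le _ _
    _ ≤ KY * (‖X‖ * Kc) := by
        gcongr
        · exact hY x
        · exact (norm_app_le _ _).trans (by gcongr)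
    _ = _ := by ring

/-- The identity `vec (Y X c) = (cᵀ ⊗ Y) vec X`. It turns the diversity condition on the Gram matrix
into a lower bound on the energy of the model values. -/
theorem regressor_mulVec_vec (j t : ℕ) (X : Mat p h) (r : Fin n) :
    (regressor P τ j t *ᵥ X.vec) ((), r) = P.model (τ.x j t) X (τ.c j) r := by
  rw [regressor, Matrix.kronecker_mulVec_vec]
  simp only [Matrix.vec, Plant.model_apply, Matrix.mul_apply, Matrix.transpose_apply,
    Matrix.replicateRow_apply, Finset.sum_mul, Finset.mul_sum]
  rw [Finset.sum_comm]
  simp only [mul_assoc]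

theorem vec_dotProduct_vec {a b : ℕ} (X : Mat a b) : X.vec ⬝ᵥ X.vec = ‖X‖ ^ 2 := by
  rw [frobenius_norm_sq, dotProduct, Fintype.sum_prod_type, Finset.sum_comm]
  simp [Matrix.vec, sq]

theorem isHermitian_gram (T i : ℕ) : (gram P τ T i).IsHermitian := by
  rw [Matrix.IsHermitian, Matrix.conjTranspose_eq_transpose_of_trivial]
  simp [gram, Matrix.transpose_sum, Matrix.transpose_mul]

theorem vec_dotProduct_gram_mulVec (T i : ℕ) (X : Mat p h) :
    X.vec ⬝ᵥ gram P τ T i *ᵥ X.vec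
      = ∑ j ∈ Finset.Icc 1 i, ∑ t ∈ Finset.Icc 1 T, ‖P.model (τ.x j t) X (τ.c j)‖ ^ 2 := by
  simp only [gram, Matrix.sum_mulVec, dotProduct_sum]
  refine Finset.sum_congr rfl fun j _ => Finset.sum_congr rfl fun t _ => ?_
  rw [← Matrix.mulVec_mulVec, Matrix.dotProduct_mulVec, Matrix.vecMul_transpose, dotProduct,
    Fintype.sum_prod_type, norm_sq_eq_sum]
  simp [regressor_mulVec_vec, sq]

theorem minEigenvalue_gram_mul_le (T i : ℕ) (X : Mat p h) :
    minEigenvalue (gram P τ T i) * ‖X‖ ^ 2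
      ≤ ∑ j ∈ Finset.Icc 1 i, ∑ t ∈ Finset.Icc 1 T, ‖P.model (τ.x j t) X (τ.c j)‖ ^ 2 := by
  rw [← vec_dotProduct_gram_mulVec, ← vec_dotProduct_vec]
  exact minEigenvalue_mul_le (isHermitian_gram P τ T i) _

end Regressor

end OMAC

/-! ### Exponential supermartingale and its tail bound. -/

theorem Real.exp_le_add_exp_sq (x : ℝ) : Real.exp x ≤ x + Real.exp (x ^ 2) := by
  have h2 : x ^ 2 + 1 ≤ Real.exp (x ^ 2) := Real.add_one_le_exp _
  -- For `|x| ≤ 1`, `exp x ≤ 1 + x + x²`; for `x > 1`, `x ≤ x²`; for `x < -1`, `exp x ≤ 1` and `x +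
  -- x² ≥ 0`.
  rcases le_or_gt |x| 1 with h | h
  · have := (abs_le.1 (Real.abs_exp_sub_one_sub_id_le h)).2
    linarith
  · rcases lt_abs.1 h with h | h
    · have : Real.exp x ≤ Real.exp (x ^ 2) := Real.exp_le_exp.2 (by nlinarith)
      linarith
    · have : Real.exp x ≤ 1 := Real.exp_le_one_iff.2 (by linarith)
      nlinarith

namespace OMAC

open MeasureTheory Filter Topology

section Measurability

variable {Ω : Type*} {m : MeasurableSpace Ω} {n : ℕ}

theorem measurable_sub_norm_sq (W : ℝ) {f : Ω → ℝ} {a : Ω → Vec n} (hf : Measurable f)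
    (ha : Measurable a) : Measurable fun ω => f ω - W ^ 2 * ‖a ω‖ ^ 2 :=
  hf.sub ((ha.norm.pow_const 2).const_mul _)

theorem measurable_inner_sub_norm_sq (W : ℝ) {a w : Ω → Vec n} (ha : Measurable a)
    (hw : Measurable w) : Measurable fun ω => inner ℝ (a ω) (w ω) - W ^ 2 * ‖a ω‖ ^ 2 :=
  measurable_sub_norm_sq W (ha.inner hw) ha

end Measurability

section Probability

variable {Ω : Type*} {m₀ : MeasurableSpace Ω} {μ : Measure Ω}

/-- A number all of whose multiples satisfy `1 + s x ≤ exp (s² c)` vanishes. -/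
theorem eq_zero_of_forall_one_add_le_exp {x c : ℝ}
    (hx : ∀ q : ℚ, 1 + q * x ≤ Real.exp ((q : ℝ) ^ 2 * c)) : x = 0 := by
  -- Assuming only rational multiples lets the lemma be applied off a countable union of null sets;
  -- density recovers all real `s`.
  have hs : ∀ s : ℝ, 1 + s * x ≤ Real.exp (s ^ 2 * c) := by
    intro s
    have hcl : IsClosed {s : ℝ | 1 + s * x ≤ Real.exp (s ^ 2 * c)} :=
      isClosed_le (by fun_prop) (by fun_prop)
    exact Rat.isDenseEmbedding_coe_real.dense.induction_on (p := fun s : ℝ =>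
      1 + s * x ≤ Real.exp (s ^ 2 * c)) s hcl (fun q => hx q)
  -- The difference is nonnegative and vanishes at `0`, so its derivative there, `-x`, is zero.
  have hmin : IsLocalMin (fun s : ℝ => Real.exp (s ^ 2 * c) - (1 + s * x)) 0 :=
    Filter.Eventually.of_forall fun s => by have := hs s; simp; linarith
  have hd : HasDerivAt (fun s : ℝ => Real.exp (s ^ 2 * c) - (1 + s * x)) (-x) 0 := by
    have h1 : HasDerivAt (fun s : ℝ => Real.exp (s ^ 2 * c)) 0 0 := by
      have := (((hasDerivAt_id (0 : ℝ)).pow 2).mul_const c).exp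
      simpa using this
    have h2 : HasDerivAt (fun s : ℝ => 1 + s * x) x 0 := by
      simpa using ((hasDerivAt_id (0 : ℝ)).mul_const x).const_add 1
    exact (h1.sub h2).congr_deriv (by simp)
  have := hmin.hasDerivAt_eq_zero hd
  linarith

/-- Combining `1 + s X ≤ exp (s X)` with the sub-Gaussian bound and comparing first-order terms at
`s = 0` forces the conditional mean to vanish. The tail bounds use sub-Gaussianity only through this
centring; the size of the noise enters through `W`. -/
theorem IsCondSubGaussian.condExp_eq_zero [IsProbabilityMeasure μ] {m : MeasurableSpace Ω}
    (hm : m ≤ m₀) {R : ℝ} {X : Ω → ℝ} (hX : IsCondSubGaussian m R X μ) (hi : Integrable X μ) :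
    μ[X | m] =ᵐ[μ] 0 := by
  have key : ∀ q : ℚ, ∀ᵐ ω ∂μ,
      1 + (q : ℝ) * (μ[X | m]) ω ≤ Real.exp ((q : ℝ) ^ 2 * (R ^ 2 / 2)) := by
    intro q
    obtain ⟨hint, hle⟩ := hX q
    have hlin : Integrable (fun ω => (1 : ℝ) + (q : ℝ) * X ω) μ :=
      (integrable_const _).add (hi.const_mul _)
    have h1 : μ[fun ω => (1 : ℝ) + (q : ℝ) * X ω | m]
        ≤ᵐ[μ] μ[fun ω => Real.exp (q * X ω) | m] :=
      condExp_mono hlin hint (Eventually.of_forall fun ω => by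
        have := Real.add_one_le_exp ((q : ℝ) * X ω)
        simp only; linarith)
    have h2 : μ[fun ω => (1 : ℝ) + (q : ℝ) * X ω | m]
        =ᵐ[μ] μ[fun _ => (1 : ℝ) | m] + μ[(q : ℝ) • X | m] :=
      condExp_add (integrable_const (1 : ℝ)) (hi.smul (q : ℝ)) m
    have h3 := condExp_smul (μ := μ) (q : ℝ) X m
    rw [condExp_const hm] at h2
    filter_upwards [h1, h2, h3, hle] with ω h1 h2 h3 h4
    simp only [Pi.add_apply, Pi.smul_apply, smul_eq_mul] at h2 h3
    rw [h2, h3] at h1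
    refine h1.trans (h4.trans (le_of_eq ?_))
    ring_nf
  filter_upwards [ae_all_iff.2 key] with ω hω
  exact eq_zero_of_forall_one_add_le_exp hω

theorem integral_mul_eq_zero_of_condExp [IsProbabilityMeasure μ] {m : MeasurableSpace Ω}
    (hm : m ≤ m₀) {b X : Ω → ℝ} {B : ℝ} (hb : Measurable[m] b) (hB : ∀ᵐ ω ∂μ, |b ω| ≤ B)
    (hi : Integrable X μ) (h0 : μ[X | m] =ᵐ[μ] 0) : ∫ ω, b ω * X ω ∂μ = 0 := by
  have hbi : Integrable (b * X) μ :=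
    hi.bdd_mul (hb.mono hm le_rfl).aestronglyMeasurable hB
  have h1 := condExp_mul_of_stronglyMeasurable_left (m := m) hb.stronglyMeasurable hbi hi
  have h2 : ∫ ω, (b * X) ω ∂μ = 0 := by
    rw [← integral_condExp hm]
    refine integral_eq_zero_of_ae ?_
    filter_upwards [h1, h0] with ω h1 h0
    rw [h1, Pi.mul_apply, h0]; simp
  exact h2

variable {n : ℕ} {ℱ : Filtration ℕ m₀} {a w : ℕ → Ω → Vec n} {A W : ℝ}

/-- The logarithm of the exponential supermartingale attached to a predictable integrand `a`
and to a noise `w` bounded by `W`. -/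
noncomputable def expProcess (W : ℝ) (a w : ℕ → Ω → Vec n) (K : ℕ) (ω : Ω) : ℝ :=
  ∑ k ∈ Finset.range K, (inner ℝ (a k ω) (w k ω) - W ^ 2 * ‖a k ω‖ ^ 2)

theorem measurable_expProcess {K : ℕ} (ha : ∀ k < K, Measurable[ℱ k] (a k))
    (hw : ∀ k < K, Measurable[ℱ (k + 1)] (w k)) : Measurable[ℱ K] (expProcess W a w K) := by
  unfold expProcess
  refine Finset.measurable_sum _ fun k hk => ?_
  rw [Finset.mem_range] at hk
  have h1 : Measurable[ℱ K] (a k) := (ha k hk).mono (ℱ.mono hk.le) le_rfl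
  have h2 : Measurable[ℱ K] (w k) := (hw k hk).mono (ℱ.mono hk) le_rfl
  exact measurable_inner_sub_norm_sq W h1 h2

/-- A crude bound that makes the exponentials integrable; its size never enters the tail estimate.
-/
theorem ae_expProcess_le {K : ℕ} (hA : ∀ k < K, ∀ᵐ ω ∂μ, ‖a k ω‖ ≤ A)
    (hW : ∀ k < K, ∀ᵐ ω ∂μ, ‖w k ω‖ ≤ W) :
    ∀ᵐ ω ∂μ, expProcess W a w K ω ≤ K * (A * W) := by
  have h1 : ∀ᵐ ω ∂μ, ∀ k, k < K → ‖a k ω‖ ≤ A :=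
    ae_all_iff.2 fun k => (em (k < K)).elim (fun hk => (hA k hk).mono fun _ h _ => h)
      (fun hk => Eventually.of_forall fun _ h => absurd h hk)
  have h2 : ∀ᵐ ω ∂μ, ∀ k, k < K → ‖w k ω‖ ≤ W :=
    ae_all_iff.2 fun k => (em (k < K)).elim (fun hk => (hW k hk).mono fun _ h _ => h)
      (fun hk => Eventually.of_forall fun _ h => absurd h hk)
  filter_upwards [h1, h2] with ω h1 h2
  calc expProcess W a w K ω ≤ ∑ _k ∈ Finset.range K, A * W := by
        refine Finset.sum_le_sum fun k hk => ?_
        rw [Finset.mem_range] at hk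
        have h3 := real_inner_le_norm (a k ω) (w k ω)
        have h4 : ‖a k ω‖ * ‖w k ω‖ ≤ A * W :=
          mul_le_mul (h1 k hk) (h2 k hk) (norm_nonneg _) ((norm_nonneg _).trans (h1 k hk))
        have : 0 ≤ W ^ 2 * ‖a k ω‖ ^ 2 := by positivity
        linarith
    _ = K * (A * W) := by simp

theorem integrable_exp_expProcess [IsProbabilityMeasure μ] {K : ℕ}
    (ha : ∀ k < K, Measurable[ℱ k] (a k))
    (hw : ∀ k < K, Measurable[ℱ (k + 1)] (w k)) (hA : ∀ k < K, ∀ᵐ ω ∂μ, ‖a k ω‖ ≤ A)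
    (hW : ∀ k < K, ∀ᵐ ω ∂μ, ‖w k ω‖ ≤ W) :
    Integrable (fun ω => Real.exp (expProcess W a w K ω)) μ := by
  refine Integrable.of_bound
    ((measurable_expProcess ha hw).mono (ℱ.le K) le_rfl).exp.aestronglyMeasurable
    (Real.exp (K * (A * W))) ?_
  filter_upwards [ae_expProcess_le hA hW] with ω h
  rw [Real.norm_eq_abs, Real.abs_exp]
  exact Real.exp_le_exp.2 h

/-- With `ξ = ⟨a_K, w_K⟩`, use `exp ξ ≤ ξ + exp (ξ²)` and `ξ² ≤ W² ‖a_K‖²`. The linear term has mean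
zero against the predictable factor, and the remaining exponential cancels the compensator. -/
theorem integral_exp_expProcess_le_one [IsProbabilityMeasure μ] {K : ℕ}
    (ha : ∀ k < K, Measurable[ℱ k] (a k))
    (hw : ∀ k < K, Measurable[ℱ (k + 1)] (w k)) (hA : ∀ k < K, ∀ᵐ ω ∂μ, ‖a k ω‖ ≤ A)
    (hW : ∀ k < K, ∀ᵐ ω ∂μ, ‖w k ω‖ ≤ W)
    (h0 : ∀ k < K, ∀ l, μ[fun ω => w k ω l | ℱ k] =ᵐ[μ] 0) :
    ∫ ω, Real.exp (expProcess W a w K ω) ∂μ ≤ 1 := by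
  induction K with
  | zero => simp [expProcess]
  | succ K ih =>
    have lt : ∀ k, k < K → k < K + 1 := fun k hk => hk.trans K.lt_succ_self
    have ih := ih (fun k hk => ha k (lt k hk)) (fun k hk => hw k (lt k hk))
      (fun k hk => hA k (lt k hk)) (fun k hk => hW k (lt k hk)) (fun k hk => h0 k (lt k hk))
    have hSm : Measurable[ℱ K] (expProcess W a w K) :=
      measurable_expProcess (fun k hk => ha k (lt k hk)) (fun k hk => hw k (lt k hk))
    have hSi : Integrable (fun ω => Real.exp (expProcess W a w K ω)) μ :=
      integrable_exp_expProcess (fun k hk => ha k (lt k hk)) (fun k hk => hw k (lt k hk))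
        (fun k hk => hA k (lt k hk)) (fun k hk => hW k (lt k hk))
    have hSb := ae_expProcess_le (fun k hk => hA k (lt k hk)) (fun k hk => hW k (lt k hk))
    have haK := ha K K.lt_succ_self
    have hAK := hA K K.lt_succ_self
    have hWK := hW K K.lt_succ_self
    have hwK : Measurable (w K) := (hw K K.lt_succ_self).mono (ℱ.le _) le_rfl
    -- The compensator of step `K` is already known at time `K`, so it belongs to the predictable
    -- factor.
    set D : Ω → ℝ := fun ω => Real.exp (expProcess W a w K ω - W ^ 2 * ‖a K ω‖ ^ 2) with hD
    have hDm : Measurable[ℱ K] D := (measurable_sub_norm_sq W hSm haK).exp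
    have hwl : ∀ l, Integrable (fun ω => w K ω l) μ := fun l =>
      Integrable.of_bound (by fun_prop) W (hWK.mono fun ω h => (PiLp.norm_apply_le _ _).trans h)
    have hal : ∀ l, Measurable[ℱ K] (fun ω => a K ω l) := fun l =>
      (EuclideanSpace.proj (𝕜 := ℝ) l).continuous.measurable.comp haK
    have hDal : ∀ l, ∀ᵐ ω ∂μ, |D ω * a K ω l| ≤ Real.exp (K * (A * W)) * A := by
      intro l
      filter_upwards [hSb, hAK] with ω h1 h2
      rw [abs_mul]
      refine mul_le_mul ?_ ((PiLp.norm_apply_le _ _).trans h2) (abs_nonneg _) (by positivity)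
      rw [hD, Real.abs_exp]
      refine Real.exp_le_exp.2 ?_
      have : 0 ≤ W ^ 2 * ‖a K ω‖ ^ 2 := by positivity
      linarith
    have hDm' : ∀ l, Measurable[ℱ K] (fun ω => D ω * a K ω l) := fun l => hDm.mul (hal l)
    have hterm : ∀ l, Integrable (fun ω => D ω * a K ω l * w K ω l) μ := fun l =>
      (hwl l).bdd_mul ((hDm' l).mono (ℱ.le K) le_rfl).aestronglyMeasurable (hDal l)
    have hzero : ∀ l, ∫ ω, D ω * a K ω l * w K ω l ∂μ = 0 := fun l =>
      integral_mul_eq_zero_of_condExp (ℱ.le K) (hDm' l) (hDal l) (hwl l)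
        (h0 K K.lt_succ_self l)
    have hsum : ∫ ω, ∑ l, D ω * a K ω l * w K ω l ∂μ = 0 := by
      rw [integral_finsetSum _ fun l _ => hterm l]
      exact Finset.sum_eq_zero fun l _ => hzero l
    have hle : ∀ᵐ ω ∂μ, Real.exp (expProcess W a w (K + 1) ω)
        ≤ (∑ l, D ω * a K ω l * w K ω l) + Real.exp (expProcess W a w K ω) := by
      filter_upwards [hWK] with ω hω
      set ξ : ℝ := inner ℝ (a K ω) (w K ω) with hξ
      have e1 : ∑ l, D ω * a K ω l * w K ω l = D ω * ξ := by
        rw [hξ, PiLp.inner_apply, Finset.mul_sum]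
        refine Finset.sum_congr rfl fun l _ => ?_
        simp only [RCLike.inner_apply, conj_trivial]
        ring
      have e2 : Real.exp (expProcess W a w (K + 1) ω) = D ω * Real.exp ξ := by
        rw [hD, ← Real.exp_add, expProcess, Finset.sum_range_succ, ← expProcess]
        congr 1; ring
      have e3 : Real.exp (expProcess W a w K ω) = D ω * Real.exp (W ^ 2 * ‖a K ω‖ ^ 2) := by
        rw [hD, ← Real.exp_add]; congr 1; ring
      have h1 : |ξ| ≤ ‖a K ω‖ * W :=
        (abs_real_inner_le_norm _ _).trans (by gcongr)
      have h2 : ξ ^ 2 ≤ W ^ 2 * ‖a K ω‖ ^ 2 := by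
        rw [← sq_abs, ← mul_pow, mul_comm W]
        exact pow_le_pow_left₀ (abs_nonneg _) h1 2
      have h3 : Real.exp ξ ≤ ξ + Real.exp (W ^ 2 * ‖a K ω‖ ^ 2) :=
        (Real.exp_le_add_exp_sq ξ).trans (by gcongr)
      rw [e1, e2, e3, ← mul_add]
      exact mul_le_mul_of_nonneg_left h3 (Real.exp_pos _).le
    have hsi : Integrable (fun ω => ∑ l, D ω * a K ω l * w K ω l) μ :=
      integrable_finsetSum _ fun l _ => hterm l
    calc ∫ ω, Real.exp (expProcess W a w (K + 1) ω) ∂μ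
        ≤ ∫ ω, ((∑ l, D ω * a K ω l * w K ω l) + Real.exp (expProcess W a w K ω)) ∂μ :=
          integral_mono_ae (integrable_exp_expProcess ha hw hA hW) (hsi.add hSi) hle
      _ = ∫ ω, Real.exp (expProcess W a w K ω) ∂μ := by
          rw [integral_add hsi hSi, hsum, zero_add]
      _ ≤ 1 := ih

theorem measureReal_expProcess_ge_le [IsProbabilityMeasure μ] {K : ℕ}
    (ha : ∀ k < K, Measurable[ℱ k] (a k))
    (hw : ∀ k < K, Measurable[ℱ (k + 1)] (w k)) (hA : ∀ k < K, ∀ᵐ ω ∂μ, ‖a k ω‖ ≤ A)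
    (hW : ∀ k < K, ∀ᵐ ω ∂μ, ‖w k ω‖ ≤ W)
    (h0 : ∀ k < K, ∀ l, μ[fun ω => w k ω l | ℱ k] =ᵐ[μ] 0) (L : ℝ) :
    μ.real {ω | L ≤ expProcess W a w K ω} ≤ Real.exp (-L) := by
  have h := ProbabilityTheory.measure_ge_le_exp_mul_mgf (μ := μ) (X := expProcess W a w K)
    (t := 1) L zero_le_one (by simpa using integrable_exp_expProcess ha hw hA hW)
  have h1 : ProbabilityTheory.mgf (expProcess W a w K) μ 1 ≤ 1 := by
    simpa [ProbabilityTheory.mgf] using integral_exp_expProcess_le_one ha hw hA hW h0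
  calc _ ≤ _ := h
    _ ≤ Real.exp (-1 * L) * 1 := by gcongr
    _ = Real.exp (-L) := by simp

end Probability

end OMAC

namespace OMAC

/-! ### Pathwise bounds: stability, regret, and minimality of the ridge cost. -/

section PathBounds

open Finset

/-- The induction proves an exact identity whose extra term, the convolution at time `T + 1`, is
nonnegative and is dropped. -/
theorem sum_geometric_convolution_le {ρ : ℝ} (hρ₀ : 0 ≤ ρ) (hρ₁ : ρ < 1) (b : ℕ → ℝ)
    (hb : ∀ k, 0 ≤ b k) (T : ℕ) :
    ∑ t ∈ Icc 1 T, ∑ k ∈ Icc 1 (t - 1), ρ ^ (t - 1 - k) * b k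
      ≤ 1 / (1 - ρ) * ∑ t ∈ Icc 1 T, b t := by
  have key : (1 - ρ) * ∑ t ∈ Icc 1 T, ∑ k ∈ Icc 1 (t - 1), ρ ^ (t - 1 - k) * b k
      + ∑ k ∈ Icc 1 T, ρ ^ (T - k) * b k = ∑ t ∈ Icc 1 T, b t := by
    induction T with
    | zero => simp
    | succ T ih =>
      rw [sum_Icc_succ_top (by omega), sum_Icc_succ_top (by omega), sum_Icc_succ_top (by omega),
        ← ih]
      have h1 : ∑ k ∈ Icc 1 T, ρ ^ (T + 1 - k) * b k
          = ρ * ∑ k ∈ Icc 1 T, ρ ^ (T - k) * b k := by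
        rw [mul_sum]
        refine sum_congr rfl fun k hk => ?_
        rw [show T + 1 - k = (T - k) + 1 by have := (mem_Icc.1 hk).2; omega]
        ring
      rw [h1]
      simp only [Nat.add_sub_cancel, Nat.sub_self, pow_zero]
      ring
  have h2 : 0 ≤ ∑ k ∈ Icc 1 T, ρ ^ (T - k) * b k :=
    sum_nonneg fun k _ => mul_nonneg (pow_nonneg hρ₀ _) (hb k)
  rw [one_div, inv_mul_eq_div, le_div_iff₀ (by linarith)]
  linarith

theorem sum_sum_le_sqrt (N T : ℕ) (b : ℕ → ℕ → ℝ) :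
    1 / ((T : ℝ) * N) * ∑ i ∈ Icc 1 N, ∑ t ∈ Icc 1 T, b i t
      ≤ √(1 / ((T : ℝ) * N) * ∑ i ∈ Icc 1 N, ∑ t ∈ Icc 1 T, b i t ^ 2) := by
  refine Real.le_sqrt_of_sq_le ?_
  rcases eq_or_lt_of_le (show (0 : ℝ) ≤ (T : ℝ) * N by positivity) with h | h
  · rw [← h]; simp
  have h1 := sq_sum_le_card_mul_sum_sq (s := Icc 1 N ×ˢ Icc 1 T) (f := fun q => b q.1 q.2)
  rw [sum_product, sum_product, card_product, Nat.card_Icc, Nat.card_Icc] at h1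
  simp only [Nat.add_sub_cancel, Nat.cast_mul] at h1
  calc _ = 1 / ((T : ℝ) * N) ^ 2 * (∑ i ∈ Icc 1 N, ∑ t ∈ Icc 1 T, b i t) ^ 2 := by
        rw [mul_pow, one_div_pow]
    _ ≤ 1 / ((T : ℝ) * N) ^ 2 * (N * T * ∑ i ∈ Icc 1 N, ∑ t ∈ Icc 1 T, b i t ^ 2) := by
        gcongr
    _ = _ := by field_simp

variable {n m p h : ℕ} {P : Plant n m p h} {τ : Traj n m p h} {N T : ℕ} {lam : ℝ}
  {Θ₁ : Mat p h} {K₂ : Set (Vec h)} {A₂ : Vec h → List (Vec h → ℝ) → Vec h}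

theorem IsRun.obs_eq (hrun : IsRun P τ N T lam Θ₁ K₂ A₂) {i t : ℕ} (hi : i ∈ Icc 1 N)
    (ht : t ∈ Icc 1 T) : obs P τ i t = P.model (τ.x i t) P.Θ (τ.c i) - τ.w i t := by
  rw [obs, hrun.dynamics i hi t ht]
  abel

theorem IsRun.loss_eq (hrun : IsRun P τ N T lam Θ₁ K₂ A₂) {i t : ℕ} (hi : i ∈ Icc 1 N)
    (ht : t ∈ Icc 1 T) (X : Mat p h) :
    loss P τ i t X (τ.c i) = ‖P.model (τ.x i t) (X - P.Θ) (τ.c i) + τ.w i t‖ ^ 2 := by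
  rw [loss, hrun.obs_eq hi ht, Plant.model_sub]
  congr 2
  abel

theorem IsRun.state_eq (hrun : IsRun P τ N T lam Θ₁ K₂ A₂) (hB : ∀ x, (P.B x).rank = n)
    {i t : ℕ} (hi : i ∈ Icc 1 N) (ht : t ∈ Icc 1 T) :
    τ.x i (t + 1) = P.f₀ (τ.x i t)
      + (P.model (τ.x i t) (τ.Θhat i) (τ.chat i t) - obs P τ i t) := by
  rw [obs, hrun.control i hi t ht, app_app_pinv _ (hB _)]
  abel

theorem IsRun.ace_le_sqrt {β γ ρ : ℝ} (hγ : 0 ≤ γ) (hρ₀ : 0 ≤ ρ) (hρ₁ : ρ < 1)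
    (hrun : IsRun P τ N T lam Θ₁ K₂ A₂) (hB : ∀ x, (P.B x).rank = n)
    (hS : IsEISS P.f₀ β γ ρ) :
    ace τ N T ≤ γ / (1 - ρ) * √(1 / ((T : ℝ) * N)
      * ∑ i ∈ Icc 1 N, ∑ t ∈ Icc 1 T, innerCost P τ i t (τ.chat i t)) := by
  set v : ℕ → ℕ → ℝ := fun i t =>
    ‖P.model (τ.x i t) (τ.Θhat i) (τ.chat i t) - obs P τ i t‖ with hv
  have h1 : ∀ i ∈ Icc 1 N, ∑ t ∈ Icc 1 T, ‖τ.x i t‖ ≤ γ / (1 - ρ) * ∑ t ∈ Icc 1 T, v i t := by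
    intro i hi
    calc ∑ t ∈ Icc 1 T, ‖τ.x i t‖
        ≤ ∑ t ∈ Icc 1 T, γ * ∑ k ∈ Icc 1 (t - 1), ρ ^ (t - 1 - k) * v i k := by
          refine sum_le_sum fun t ht => ?_
          rw [mem_Icc] at ht
          have := hS (τ.x i)
            (fun k => P.model (τ.x i k) (τ.Θhat i) (τ.chat i k) - obs P τ i k) t ht.1
            (fun k hk => hrun.state_eq hB hi (by rw [mem_Icc] at hk ⊢; omega))
          simpa [hrun.start i hi] using this
      _ = γ * ∑ t ∈ Icc 1 T, ∑ k ∈ Icc 1 (t - 1), ρ ^ (t - 1 - k) * v i k := by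
          rw [mul_sum]
      _ ≤ γ * (1 / (1 - ρ) * ∑ t ∈ Icc 1 T, v i t) := by
          gcongr
          exact sum_geometric_convolution_le hρ₀ hρ₁ (v i) (fun _ => norm_nonneg _) T
      _ = _ := by ring
  have hc : 0 ≤ γ / (1 - ρ) := div_nonneg hγ (by linarith)
  calc ace τ N T ≤ 1 / ((T : ℝ) * N) * ∑ i ∈ Icc 1 N, γ / (1 - ρ) * ∑ t ∈ Icc 1 T, v i t := by
        unfold ace
        gcongr with i hi
        exact h1 i hi
    _ = γ / (1 - ρ) * (1 / ((T : ℝ) * N) * ∑ i ∈ Icc 1 N, ∑ t ∈ Icc 1 T, v i t) := by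
        rw [← mul_sum]; ring
    _ ≤ _ := by
        gcongr
        exact sum_sum_le_sqrt N T v

theorem sum_innerCost_le (hc : ∀ i ∈ Icc 1 N, τ.c i ∈ K₂) :
    ∑ i ∈ Icc 1 N, ∑ t ∈ Icc 1 T, innerCost P τ i t (τ.chat i t)
      ≤ innerRegret P τ K₂ N T + ∑ i ∈ Icc 1 N, ∑ t ∈ Icc 1 T, innerCost P τ i t (τ.c i) := by
  rw [innerRegret, ← sum_add_distrib]
  refine sum_le_sum fun i hi => ?_
  have : ⨅ c' : K₂, ∑ t ∈ Icc 1 T, innerCost P τ i t (c' : Vec h)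
      ≤ ∑ t ∈ Icc 1 T, innerCost P τ i t (τ.c i) := by
    -- A real infimum is a lower bound only for a family bounded below; the costs are sums of
    -- squares, so `0` serves.
    refine ciInf_le (f := fun c' : K₂ => ∑ t ∈ Icc 1 T, innerCost P τ i t (c' : Vec h))
      ⟨0, ?_⟩ ⟨τ.c i, hc i hi⟩
    rintro _ ⟨c', rfl⟩
    exact sum_nonneg fun t _ => sq_nonneg _
  linarith

theorem IsRun.outerCost_eq (hrun : IsRun P τ N T lam Θ₁ K₂ A₂) {i : ℕ} (hi : i ∈ Icc 1 N)
    (X : Mat p h) :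
    outerCost P τ T lam i X = lam * ‖X‖ ^ 2
      + ∑ j ∈ Icc 1 i, ∑ t ∈ Icc 1 T,
          ‖P.model (τ.x j t) (X - P.Θ) (τ.c j) + τ.w j t‖ ^ 2 := by
  rw [outerCost]
  congr 1
  refine sum_congr rfl fun j hj => sum_congr rfl fun t ht => hrun.loss_eq ?_ ht X
  rw [mem_Icc] at *
  omega

/-- Compare the minimiser with the true `Θ`: the terms `‖w‖²` occur in both costs and cancel. -/
theorem IsRun.ridge_inequality (hrun : IsRun P τ N T lam Θ₁ K₂ A₂) {i : ℕ} (hi : i ∈ Icc 1 N) :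
    lam * ‖τ.Θhat (i + 1)‖ ^ 2
      + ∑ j ∈ Icc 1 i, ∑ t ∈ Icc 1 T,
          ‖P.model (τ.x j t) (τ.Θhat (i + 1) - P.Θ) (τ.c j)‖ ^ 2
      + 2 * ∑ j ∈ Icc 1 i, ∑ t ∈ Icc 1 T,
          inner ℝ (P.model (τ.x j t) (τ.Θhat (i + 1) - P.Θ) (τ.c j)) (τ.w j t)
      ≤ lam * ‖P.Θ‖ ^ 2 := by
  have h1 := hrun.outer_step i hi P.Θ
  rw [hrun.outerCost_eq hi, hrun.outerCost_eq hi] at h1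
  simp only [norm_add_sq_real, sum_add_distrib, ← mul_sum, sub_self] at h1
  have h2 : ∀ j t, P.model (τ.x j t) 0 (τ.c j) = 0 := by
    intro j t; ext r; simp [Plant.model_apply]
  simp only [h2, norm_zero, inner_zero_left, sum_const_zero] at h1
  norm_num at h1
  linarith

/-- The same comparison with the residuals dropped. It holds whatever the direction of the noise and
confines the estimate to a box that a finite grid can cover. -/
theorem IsRun.norm_sq_estimate_le (hrun : IsRun P τ N T lam Θ₁ K₂ A₂) {W : ℝ}
    (hw : ∀ i ∈ Icc 1 N, ∀ t ∈ Icc 1 T, ‖τ.w i t‖ ≤ W) {i : ℕ} (hi : i ∈ Icc 1 N) :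
    lam * ‖τ.Θhat (i + 1)‖ ^ 2 ≤ lam * ‖P.Θ‖ ^ 2 + N * T * W ^ 2 := by
  have h1 := hrun.outer_step i hi P.Θ
  rw [hrun.outerCost_eq hi, hrun.outerCost_eq hi] at h1
  have h2 : ∀ j t, P.model (τ.x j t) 0 (τ.c j) = 0 := by
    intro j t; ext r; simp [Plant.model_apply]
  simp only [h2, sub_self, zero_add] at h1
  have h3 : ∑ j ∈ Icc 1 i, ∑ t ∈ Icc 1 T, ‖τ.w j t‖ ^ 2 ≤ N * T * W ^ 2 := by
    calc ∑ j ∈ Icc 1 i, ∑ t ∈ Icc 1 T, ‖τ.w j t‖ ^ 2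
        ≤ ∑ j ∈ Icc 1 N, ∑ t ∈ Icc 1 T, ‖τ.w j t‖ ^ 2 :=
          sum_le_sum_of_subset_of_nonneg (Icc_subset_Icc_right (mem_Icc.1 hi).2)
            fun _ _ _ => by positivity
      _ ≤ ∑ _j ∈ Icc 1 N, ∑ _t ∈ Icc 1 T, W ^ 2 :=
          sum_le_sum fun j hj => sum_le_sum fun t ht =>
            pow_le_pow_left₀ (norm_nonneg _) (hw j hj t ht) 2
      _ = _ := by simp [mul_assoc]
  have h4 : 0 ≤ ∑ j ∈ Icc 1 i, ∑ t ∈ Icc 1 T,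
      ‖P.model (τ.x j t) (τ.Θhat (i + 1) - P.Θ) (τ.c j) + τ.w j t‖ ^ 2 := by positivity
  linarith

end PathBounds

end OMAC

namespace OMAC

open Matrix Finset

/-! ### Closed form of the ridge estimate. -/

section RidgeSolution

theorem eq_zero_of_forall_quadratic_nonneg {a b : ℝ} (hab : ∀ s : ℝ, 0 ≤ s ^ 2 * a + s * b) :
    b = 0 := by
  by_contra hb
  have ha : 0 < |a| + 1 := by positivity
  have h1 := hab (-(b / (|a| + 1)))
  have h2 : (-(b / (|a| + 1))) ^ 2 * a + -(b / (|a| + 1)) * b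
      = b ^ 2 / (|a| + 1) ^ 2 * (a - (|a| + 1)) := by
    field_simp; ring
  rw [h2] at h1
  have h3 : 0 < b ^ 2 / (|a| + 1) ^ 2 := by positivity
  have h4 := le_abs_self a
  nlinarith

variable {n m p h : ℕ} {P : Plant n m p h} {τ : Traj n m p h} {N T : ℕ} {lam : ℝ}
  {Θ₁ : Mat p h} {K₂ : Set (Vec h)} {A₂ : Vec h → List (Vec h → ℝ) → Vec h}

/-- Right-hand side `∑_{j ≤ i} ∑_{t ≤ T} Z_t^{(j)⊤} y_t^{(j)}` of the normal equations. -/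
def normalVector (P : Plant n m p h) (τ : Traj n m p h) (T i : ℕ) : Fin h × Fin p → ℝ :=
  ∑ j ∈ Icc 1 i, ∑ t ∈ Icc 1 T,
    (regressor P τ j t)ᵀ *ᵥ fun q => (P.model (τ.x j t) P.Θ (τ.c j) - τ.w j t) q.2

theorem frobenius_norm_add_sq {a b : ℕ} (X D : Mat a b) :
    ‖X + D‖ ^ 2 = ‖X‖ ^ 2 + 2 * (D.vec ⬝ᵥ X.vec) + ‖D‖ ^ 2 := by
  rw [← vec_dotProduct_vec, ← vec_dotProduct_vec, ← vec_dotProduct_vec, Matrix.vec_add,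
    add_dotProduct, dotProduct_add, dotProduct_add, dotProduct_comm X.vec D.vec]
  ring

theorem dotProduct_regressor_mulVec (j t : ℕ) (D : Mat p h) (y : Vec n) :
    D.vec ⬝ᵥ (regressor P τ j t)ᵀ *ᵥ (fun q => y q.2)
      = inner ℝ (P.model (τ.x j t) D (τ.c j)) y := by
  rw [Matrix.dotProduct_mulVec, Matrix.vecMul_transpose, dotProduct, Fintype.sum_prod_type,
    PiLp.inner_apply]
  simp [regressor_mulVec_vec, mul_comm]

/-- Along each line `X + s D` the cost is quadratic in `s`, so minimality at `s = 0` kills the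
linear coefficient. The estimate is given only as a minimiser; the resulting closed form is what
makes it measurable. -/
theorem IsRun.normal_equations (hrun : IsRun P τ N T lam Θ₁ K₂ A₂) {i : ℕ}
    (hi : i ∈ Icc 1 N) :
    (lam • (1 : Matrix (Fin h × Fin p) (Fin h × Fin p) ℝ) + gram P τ T i)
      *ᵥ (τ.Θhat (i + 1)).vec = normalVector P τ T i := by
  set X := τ.Θhat (i + 1) with hX
  have key : ∀ D : Mat p h, D.vec ⬝ᵥ ((lam • (1 : Matrix (Fin h × Fin p) (Fin h × Fin p) ℝ)
      + gram P τ T i) *ᵥ X.vec - normalVector P τ T i) = 0 := by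
    intro D
    have hq : ∀ s : ℝ, 0 ≤ s ^ 2 * (lam * ‖D‖ ^ 2
        + ∑ j ∈ Icc 1 i, ∑ t ∈ Icc 1 T, ‖P.model (τ.x j t) D (τ.c j)‖ ^ 2)
        + s * (2 * (D.vec ⬝ᵥ ((lam • (1 : Matrix (Fin h × Fin p) (Fin h × Fin p) ℝ)
          + gram P τ T i) *ᵥ X.vec - normalVector P τ T i))) := by
      intro s
      have h1 := hrun.outer_step i hi (X + s • D)
      rw [hrun.outerCost_eq hi, hrun.outerCost_eq hi, ← hX] at h1
      have h2 : ∀ j t, P.model (τ.x j t) (X + s • D - P.Θ) (τ.c j) + τ.w j t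
          = (P.model (τ.x j t) X (τ.c j) - (P.model (τ.x j t) P.Θ (τ.c j) - τ.w j t))
            + s • P.model (τ.x j t) D (τ.c j) := by
        intro j t
        have : P.model (τ.x j t) (s • D) (τ.c j) = s • P.model (τ.x j t) D (τ.c j) := by
          ext r
          simp only [Plant.model_apply, Matrix.smul_apply, smul_eq_mul, PiLp.smul_apply,
            Finset.mul_sum]
          exact sum_congr rfl fun _ _ => sum_congr rfl fun _ _ => by ring
        rw [Plant.model_sub, Plant.model_add, this]
        abel
      have h3 : ∀ j t, P.model (τ.x j t) (X - P.Θ) (τ.c j) + τ.w j t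
          = P.model (τ.x j t) X (τ.c j) - (P.model (τ.x j t) P.Θ (τ.c j) - τ.w j t) := by
        intro j t
        rw [Plant.model_sub]; abel
      simp only [h2, h3, frobenius_norm_add_sq X (s • D)] at h1
      have h4 : ∀ j t, ‖(P.model (τ.x j t) X (τ.c j)
            - (P.model (τ.x j t) P.Θ (τ.c j) - τ.w j t))
            + s • P.model (τ.x j t) D (τ.c j)‖ ^ 2
          = ‖P.model (τ.x j t) X (τ.c j)
            - (P.model (τ.x j t) P.Θ (τ.c j) - τ.w j t)‖ ^ 2
            + 2 * s * (inner ℝ (P.model (τ.x j t) D (τ.c j)) (P.model (τ.x j t) X (τ.c j))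
              - inner ℝ (P.model (τ.x j t) D (τ.c j))
                (P.model (τ.x j t) P.Θ (τ.c j) - τ.w j t))
            + s ^ 2 * ‖P.model (τ.x j t) D (τ.c j)‖ ^ 2 := by
        intro j t
        rw [norm_add_sq_real, real_inner_smul_right, norm_smul, mul_pow, Real.norm_eq_abs,
          sq_abs, real_inner_comm, inner_sub_right]
        ring
      simp only [h4, sum_add_distrib, ← mul_sum, sum_sub_distrib] at h1
      have h5 : D.vec ⬝ᵥ ((lam • (1 : Matrix (Fin h × Fin p) (Fin h × Fin p) ℝ)
          + gram P τ T i) *ᵥ X.vec - normalVector P τ T i)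
          = lam * (D.vec ⬝ᵥ X.vec)
            + ∑ j ∈ Icc 1 i, ∑ t ∈ Icc 1 T,
              inner ℝ (P.model (τ.x j t) D (τ.c j)) (P.model (τ.x j t) X (τ.c j))
            - ∑ j ∈ Icc 1 i, ∑ t ∈ Icc 1 T, inner ℝ (P.model (τ.x j t) D (τ.c j))
                (P.model (τ.x j t) P.Θ (τ.c j) - τ.w j t) := by
        rw [dotProduct_sub, Matrix.add_mulVec, dotProduct_add, Matrix.smul_mulVec,
          Matrix.one_mulVec, dotProduct_smul, smul_eq_mul]
        congr 1
        · congr 1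
          simp only [gram, Matrix.sum_mulVec, dotProduct_sum]
          refine sum_congr rfl fun j _ => sum_congr rfl fun t _ => ?_
          rw [← Matrix.mulVec_mulVec, ← dotProduct_regressor_mulVec]
          congr 2
          ext ⟨_, r⟩
          exact regressor_mulVec_vec P τ j t X r
        · simp only [normalVector, dotProduct_sum, dotProduct_regressor_mulVec]
      have h6 : (s • D).vec ⬝ᵥ X.vec = s * (D.vec ⬝ᵥ X.vec) := by
        rw [Matrix.vec_smul, smul_dotProduct, smul_eq_mul]
      rw [h5]
      rw [h6, norm_smul, mul_pow, Real.norm_eq_abs, sq_abs] at h1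
      linarith
    have := eq_zero_of_forall_quadratic_nonneg hq
    linarith
  -- The test direction is the residual itself, with indices swapped because `vec` stacks columns.
  have h1 := key (Matrix.of fun a k => ((lam • (1 : Matrix (Fin h × Fin p) (Fin h × Fin p) ℝ)
      + gram P τ T i) *ᵥ X.vec - normalVector P τ T i) (k, a))
  exact sub_eq_zero.1 (dotProduct_self_eq_zero.1 h1)

theorem isUnit_det_add_gram (P : Plant n m p h) (τ : Traj n m p h) (hlam : 0 < lam) (T i : ℕ) :
    IsUnit (lam • (1 : Matrix (Fin h × Fin p) (Fin h × Fin p) ℝ) + gram P τ T i).det := by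
  have h1 : (gram P τ T i).PosSemidef := by
    refine Matrix.posSemidef_sum _ fun j _ => Matrix.posSemidef_sum _ fun t _ => ?_
    rw [← Matrix.conjTranspose_eq_transpose_of_trivial]
    exact Matrix.posSemidef_conjTranspose_mul_self _
  exact (((Matrix.PosDef.one).smul hlam).add_posSemidef h1).det_pos.ne'.isUnit

theorem IsRun.vec_estimate_eq (hrun : IsRun P τ N T lam Θ₁ K₂ A₂) (hlam : 0 < lam) {i : ℕ}
    (hi : i ∈ Icc 1 N) :
    (τ.Θhat (i + 1)).vec
      = (lam • (1 : Matrix (Fin h × Fin p) (Fin h × Fin p) ℝ) + gram P τ T i)⁻¹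
        *ᵥ normalVector P τ T i := by
  rw [← hrun.normal_equations hi, Matrix.mulVec_mulVec,
    Matrix.nonsing_inv_mul _ (isUnit_det_add_gram P τ hlam T i), Matrix.one_mulVec]

end RidgeSolution

/-! ### Measurability of the estimate with respect to the past. -/

section Measurability

variable {Ω : Type*} {m' : MeasurableSpace Ω}

theorem measurable_det {ι : Type*} [Fintype ι] [DecidableEq ι] {V : Ω → Matrix ι ι ℝ}
    (hV : ∀ a b, Measurable fun ω => V ω a b) : Measurable fun ω => (V ω).det := by
  simp only [Matrix.det_apply]
  exact Finset.measurable_sum _ fun σ _ =>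
    (Finset.measurable_prod _ fun i _ => hV _ _).const_smul _

/-- Cramer's rule: the inverse is the adjugate over the determinant, both polynomial in the entries.
-/
theorem measurable_inv_mulVec {ι : Type*} [Fintype ι] [DecidableEq ι] {V : Ω → Matrix ι ι ℝ}
    {b : Ω → ι → ℝ} (hV : ∀ a b, Measurable fun ω => V ω a b)
    (hb : ∀ a, Measurable fun ω => b ω a) (a : ι) :
    Measurable fun ω => ((V ω)⁻¹ *ᵥ b ω) a := by
  simp only [Matrix.mulVec, dotProduct, Matrix.inv_def, Ring.inverse_eq_inv', Matrix.smul_apply,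
    smul_eq_mul, Matrix.adjugate_apply]
  refine Finset.measurable_sum _ fun k _ =>
    (((measurable_det hV).inv).mul (measurable_det fun c d => ?_)).mul (hb k)
  by_cases hc : c = k
  · subst hc; simp
  · simpa [Matrix.updateRow_ne hc] using hV c d

variable {n m p h : ℕ} {P : Plant n m p h}

theorem measurable_coord {k : ℕ} {v : Ω → Vec k} (hv : Measurable v) (l : Fin k) :
    Measurable fun ω => v ω l :=
  (EuclideanSpace.proj (𝕜 := ℝ) l).continuous.measurable.comp hv

theorem measurable_of_coord {k : ℕ} {v : Ω → Vec k} (hv : ∀ l, Measurable fun ω => v ω l) :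
    Measurable v :=
  (WithLp.measurable_toLp 2 _).comp (measurable_pi_iff.2 hv)

theorem measurable_model (hY : ∀ a b, Measurable fun x => P.Y x a b) {x : Ω → Vec n}
    {X : Ω → Mat p h} {c : Ω → Vec h} (hx : Measurable x)
    (hX : ∀ a b, Measurable fun ω => X ω a b) (hc : Measurable c) :
    Measurable fun ω => P.model (x ω) (X ω) (c ω) := by
  refine measurable_of_coord fun r => ?_
  simp only [Plant.model_apply]
  exact Finset.measurable_sum _ fun a _ => ((hY r a).comp hx).mul
    (Finset.measurable_sum _ fun k _ => (hX a k).mul (measurable_coord hc k))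

variable {τ : Ω → Traj n m p h}

theorem measurable_regressor (hY : ∀ a b, Measurable fun x => P.Y x a b) {j t : ℕ}
    (hx : Measurable fun ω => (τ ω).x j t) (hc : Measurable fun ω => (τ ω).c j) (q r) :
    Measurable fun ω => regressor P (τ ω) j t q r := by
  simp only [regressor, Matrix.kroneckerMap_apply, Matrix.replicateRow_apply]
  exact (measurable_coord hc _).mul ((hY _ _).comp hx)

theorem measurable_gram (hY : ∀ a b, Measurable fun x => P.Y x a b) {T i : ℕ}
    (hx : ∀ j ∈ Icc 1 i, ∀ t ∈ Icc 1 T, Measurable fun ω => (τ ω).x j t)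
    (hc : ∀ j ∈ Icc 1 i, Measurable fun ω => (τ ω).c j) (q r) :
    Measurable fun ω => gram P (τ ω) T i q r := by
  simp only [gram, Matrix.sum_apply, Matrix.mul_apply, Matrix.transpose_apply]
  exact Finset.measurable_sum _ fun j hj => Finset.measurable_sum _ fun t ht =>
    Finset.measurable_sum _ fun s _ =>
      (measurable_regressor hY (hx j hj t ht) (hc j hj) _ _).mul
        (measurable_regressor hY (hx j hj t ht) (hc j hj) _ _)

theorem measurable_normalVector (hY : ∀ a b, Measurable fun x => P.Y x a b) {T i : ℕ}
    (hx : ∀ j ∈ Icc 1 i, ∀ t ∈ Icc 1 T, Measurable fun ω => (τ ω).x j t)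
    (hw : ∀ j ∈ Icc 1 i, ∀ t ∈ Icc 1 T, Measurable fun ω => (τ ω).w j t)
    (hc : ∀ j ∈ Icc 1 i, Measurable fun ω => (τ ω).c j) (q) :
    Measurable fun ω => normalVector P (τ ω) T i q := by
  simp only [normalVector, Finset.sum_apply, Matrix.mulVec, dotProduct, Matrix.transpose_apply]
  refine Finset.measurable_sum _ fun j hj => Finset.measurable_sum _ fun t ht =>
    Finset.measurable_sum _ fun s _ => ?_
  have h1 : Measurable fun ω => P.model ((τ ω).x j t) P.Θ ((τ ω).c j) - (τ ω).w j t :=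
    (measurable_model (X := fun _ => P.Θ) hY (hx j hj t ht) (fun _ _ => measurable_const)
      (hc j hj)).sub (hw j hj t ht)
  exact (measurable_regressor hY (hx j hj t ht) (hc j hj) _ _).mul (measurable_coord h1 _)

theorem measurable_estimate_succ {N T : ℕ} {lam : ℝ}
    {Θ₁ : Mat p h} {K₂ : Set (Vec h)} {A₂ : Vec h → List (Vec h → ℝ) → Vec h}
    (hrun : ∀ ω, IsRun P (τ ω) N T lam Θ₁ K₂ A₂) (hlam : 0 < lam)
    (hY : ∀ a b, Measurable fun x => P.Y x a b) {i : ℕ} (hi : i ∈ Icc 1 N)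
    (hx : ∀ j ∈ Icc 1 i, ∀ t ∈ Icc 1 T, Measurable fun ω => (τ ω).x j t)
    (hw : ∀ j ∈ Icc 1 i, ∀ t ∈ Icc 1 T, Measurable fun ω => (τ ω).w j t)
    (hc : ∀ j ∈ Icc 1 i, Measurable fun ω => (τ ω).c j) (a : Fin p) (k : Fin h) :
    Measurable fun ω => (τ ω).Θhat (i + 1) a k := by
  have h1 : ∀ ω, (τ ω).Θhat (i + 1) a k
      = ((lam • (1 : Matrix (Fin h × Fin p) (Fin h × Fin p) ℝ) + gram P (τ ω) T i)⁻¹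
        *ᵥ normalVector P (τ ω) T i) (k, a) := by
    intro ω
    rw [← (hrun ω).vec_estimate_eq hlam hi]
    rfl
  simp only [h1]
  refine measurable_inv_mulVec (fun q r => ?_) (measurable_normalVector hY hx hw hc) _
  simp only [Matrix.add_apply]
  exact (measurable_gram hY hx hc q r).const_add _

end Measurability

section RandomRun

open MeasureTheory

variable {n m p h : ℕ} {Ω : Type*} {m₀ : MeasurableSpace Ω}
  {μ : Measure Ω} {ℱ : Filtration ℕ m₀}
  {P : Plant n m p h} {τ : Ω → Traj n m p h} {N T : ℕ} {lam : ℝ} {Θ₁ : Mat p h}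
  {K₂ : Set (Vec h)} {A₂ : Vec h → List (Vec h → ℝ) → Vec h} {Kc W R : ℝ}

/-- The estimate used in environment `i` is built from environments `1, …, i - 1`, which are over by
time `(i - 1) T`; it is thus predictable throughout environment `i`. -/
theorem IsRandomRun.measurable_estimate (hτ : IsRandomRun μ ℱ P τ N T lam Θ₁ K₂ A₂ Kc W R)
    (hlam : 0 < lam) (hY : ∀ a b, Measurable fun x => P.Y x a b) {i : ℕ} (hi : i ∈ Icc 1 N)
    (a : Fin p) (k : Fin h) :
    Measurable[ℱ ((i - 1) * T)] fun ω => (τ ω).Θhat i a k := by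
  rw [mem_Icc] at hi
  obtain ⟨i, rfl⟩ : ∃ j, i = j + 1 := ⟨i - 1, by omega⟩
  rw [Nat.add_sub_cancel]
  rcases Nat.eq_zero_or_pos i with rfl | hpos
  · simp only [zero_add, (hτ.run _).outer_init]
    exact measurable_const
  have hmul : ∀ {j}, j ∈ Icc 1 i → (j - 1) * T + T ≤ i * T := by
    intro j hj
    rw [mem_Icc] at hj
    calc (j - 1) * T + T = (j - 1 + 1) * T := by ring
      _ ≤ i * T := Nat.mul_le_mul_right _ (by omega)
  have hN : ∀ {j}, j ∈ Icc 1 i → j ∈ Icc 1 N := by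
    intro j hj; rw [mem_Icc] at *; omega
  refine measurable_estimate_succ hτ.run hlam hY (by rw [mem_Icc]; omega) ?_ ?_ ?_ a k
  · intro j hj t ht
    refine (hτ.meas_x j (hN hj) t ht).mono (ℱ.mono ?_) le_rfl
    have := hmul hj; have := mem_Icc.1 ht; omega
  · intro j hj t ht
    refine (hτ.meas_w j (hN hj) t ht).mono (ℱ.mono ?_) le_rfl
    have := hmul hj; have := mem_Icc.1 ht; omega
  · intro j hj
    refine (hτ.meas_c j (hN hj)).mono (ℱ.mono ?_) le_rfl
    have := hmul hj; omega

end RandomRun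

end OMAC

namespace OMAC

open Finset

/-! ### Tail bounds along a random run. -/

section Reindexing

/-- Flattens both indices into the clock `k = (i - 1) T + (t - 1)` of the filtration. -/
theorem sum_Icc_sum_Icc_eq_sum_range (F : ℕ → ℕ → ℝ) (N : ℕ) {T : ℕ} (hT : 1 ≤ T) :
    ∑ i ∈ Icc 1 N, ∑ t ∈ Icc 1 T, F i t
      = ∑ k ∈ range (N * T), F (k / T + 1) (k % T + 1) := by
  induction N with
  | zero => simp
  | succ N ih =>
    rw [sum_Icc_succ_top (by omega), ih, add_one_mul, sum_range_add]
    congr 1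
    rw [← Finset.Ico_add_one_right_eq_Icc, sum_Ico_eq_sum_range, Nat.add_sub_cancel]
    refine sum_congr rfl fun s hs => ?_
    rw [mem_range] at hs
    rw [Nat.mul_comm N T, Nat.mul_add_div (by omega), Nat.mul_add_mod, Nat.div_eq_of_lt hs,
      Nat.mod_eq_of_lt hs, add_comm 1 s]

end Reindexing

section Tail

open MeasureTheory

variable {n m p h : ℕ} {Ω : Type*} {m₀ : MeasurableSpace Ω}
  {μ : Measure Ω} {ℱ : Filtration ℕ m₀}
  {P : Plant n m p h} {τ : Ω → Traj n m p h} {N T : ℕ} {lam : ℝ} {Θ₁ : Mat p h}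
  {K₂ : Set (Vec h)} {A₂ : Vec h → List (Vec h → ℝ) → Vec h} {Kc W R : ℝ}

theorem IsRandomRun.condExp_w_eq_zero [IsProbabilityMeasure μ]
    (hτ : IsRandomRun μ ℱ P τ N T lam Θ₁ K₂ A₂ Kc W R) {i t : ℕ} (hi : i ∈ Icc 1 N)
    (ht : t ∈ Icc 1 T) (l : Fin n) :
    μ[fun ω => (τ ω).w i t l | ℱ ((i - 1) * T + (t - 1))] =ᵐ[μ] 0 := by
  refine (hτ.subGaussian_w i hi t ht l).condExp_eq_zero (ℱ.le _) ?_
  refine Integrable.of_bound (measurable_coord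
    ((hτ.meas_w i hi t ht).mono (ℱ.le _) le_rfl) l).aestronglyMeasurable W ?_
  filter_upwards [hτ.norm_w] with ω hω
  exact (PiLp.norm_apply_le _ _).trans (hω i hi t ht)

/-- Exponential tail bound, up to the end of environment `M`, for the noise integrated against
a bounded predictable process. -/
theorem IsRandomRun.measureReal_ge_le [IsProbabilityMeasure μ]
    (hτ : IsRandomRun μ ℱ P τ N T lam Θ₁ K₂ A₂ Kc W R) (hT : 1 ≤ T) {M : ℕ} (hM : M ≤ N)
    {a : ℕ → ℕ → Ω → Vec n} {A : ℝ}
    (ha : ∀ i ∈ Icc 1 N, ∀ t ∈ Icc 1 T, Measurable[ℱ ((i - 1) * T + (t - 1))] (a i t))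
    (hA : ∀ i ∈ Icc 1 N, ∀ t ∈ Icc 1 T, ∀ᵐ ω ∂μ, ‖a i t ω‖ ≤ A) (L : ℝ) :
    μ.real {ω | L ≤ ∑ i ∈ Icc 1 M, ∑ t ∈ Icc 1 T,
      (inner ℝ (a i t ω) ((τ ω).w i t) - W ^ 2 * ‖a i t ω‖ ^ 2)} ≤ Real.exp (-L) := by
  have hi : ∀ k < M * T, k / T + 1 ∈ Icc 1 N := fun k hk => by
    have : k / T < M := Nat.div_lt_of_lt_mul (by rwa [Nat.mul_comm])
    exact mem_Icc.2 ⟨Nat.le_add_left _ _, this.trans_le hM⟩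
  have ht : ∀ k, k % T + 1 ∈ Icc 1 T := fun k => by
    have : k % T < T := Nat.mod_lt _ hT
    rw [mem_Icc]; omega
  have hk : ∀ k, (k / T + 1 - 1) * T + (k % T + 1 - 1) = k := fun k => by
    rw [Nat.add_sub_cancel, Nat.add_sub_cancel, Nat.div_add_mod']
  have h := measureReal_expProcess_ge_le (μ := μ) (ℱ := ℱ) (K := M * T) (A := A) (W := W)
    (a := fun k => a (k / T + 1) (k % T + 1))
    (w := fun k ω => (τ ω).w (k / T + 1) (k % T + 1))
    (fun k hlt => by
      have := ha _ (hi k hlt) _ (ht k)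
      rwa [hk] at this)
    (fun k hlt => by
      have := hτ.meas_w _ (hi k hlt) _ (ht k)
      rwa [show (k / T + 1 - 1) * T + (k % T + 1) = k + 1 by have := hk k; omega] at this)
    (fun k hlt => hA _ (hi k hlt) _ (ht k))
    (fun k hlt => hτ.norm_w.mono fun ω hω => hω _ (hi k hlt) _ (ht k))
    (fun k hlt l => by
      have := hτ.condExp_w_eq_zero (hi k hlt) (ht k) l
      rwa [hk] at this) L
  have e : ∀ ω, ∑ i ∈ Icc 1 M, ∑ t ∈ Icc 1 T,
      (inner ℝ (a i t ω) ((τ ω).w i t) - W ^ 2 * ‖a i t ω‖ ^ 2)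
      = expProcess W (fun k => a (k / T + 1) (k % T + 1))
        (fun k ω => (τ ω).w (k / T + 1) (k % T + 1)) (M * T) ω := fun ω =>
    sum_Icc_sum_Icc_eq_sum_range (fun i t => inner ℝ (a i t ω) ((τ ω).w i t)
      - W ^ 2 * ‖a i t ω‖ ^ 2) M hT
  simpa only [e] using h

theorem measurable_model_sub {m' : MeasurableSpace Ω} (hY : ∀ a b, Measurable fun x => P.Y x a b)
    {x : Ω → Vec n} {X : Ω → Mat p h} {c : Ω → Vec h} (hx : Measurable x)
    (hX : ∀ a b, Measurable fun ω => X ω a b) (hc : Measurable c) (X' : Mat p h) :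
    Measurable fun ω => P.model (x ω) (X ω - X') (c ω) :=
  measurable_model (X := fun ω => X ω - X') hY hx (fun a b => (hX a b).sub_const _) hc

theorem measurable_smul_model {m' : MeasurableSpace Ω} (hY : ∀ a b, Measurable fun x => P.Y x a b)
    {x : Ω → Vec n} {c : Ω → Vec h} (hx : Measurable x) (hc : Measurable c) (s : ℝ)
    (X : Mat p h) : Measurable fun ω => s • P.model (x ω) X (c ω) :=
  (measurable_model (X := fun _ => X) hY hx (fun _ _ => measurable_const) hc).const_smul s

/-- Tail bound for a deterministic direction `X`. -/
theorem IsRandomRun.measureReal_direction_ge_le [IsProbabilityMeasure μ] {KY : ℝ}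
    (hτ : IsRandomRun μ ℱ P τ N T lam Θ₁ K₂ A₂ Kc W R) (hT : 1 ≤ T)
    (hY : ∀ a b, Measurable fun x => P.Y x a b) (hKY : ∀ x, ‖P.Y x‖ ≤ KY)
    {M : ℕ} (hM : M ≤ N) (s : ℝ) (X : Mat p h) (L : ℝ) :
    μ.real {ω | L ≤ ∑ i ∈ Icc 1 M, ∑ t ∈ Icc 1 T,
      (inner ℝ (s • P.model ((τ ω).x i t) X ((τ ω).c i)) ((τ ω).w i t)
        - W ^ 2 * ‖s • P.model ((τ ω).x i t) X ((τ ω).c i)‖ ^ 2)} ≤ Real.exp (-L) := by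
  refine hτ.measureReal_ge_le hT hM
    (a := fun i t ω => s • P.model ((τ ω).x i t) X ((τ ω).c i))
    (A := |s| * (KY * Kc * ‖X‖)) (fun i hi t ht => ?_) (fun i hi t ht => ?_) L
  · exact measurable_smul_model hY (hτ.meas_x i hi t ht)
      ((hτ.meas_c i hi).mono (ℱ.mono (Nat.le_add_right _ _)) le_rfl) s X
  · filter_upwards [hτ.norm_c] with ω hω
    rw [norm_smul, Real.norm_eq_abs]
    gcongr
    exact P.norm_model_le hKY _ X (hω i hi)

/-- Tail bound for the direction of the current estimation error. -/
theorem IsRandomRun.measureReal_estimate_ge_le [IsProbabilityMeasure μ] {KY E : ℝ}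
    (hτ : IsRandomRun μ ℱ P τ N T lam Θ₁ K₂ A₂ Kc W R) (hT : 1 ≤ T) (hlam : 0 < lam)
    (hY : ∀ a b, Measurable fun x => P.Y x a b) (hKY : ∀ x, ‖P.Y x‖ ≤ KY)
    (hE : ∀ᵐ ω ∂μ, ∀ i ∈ Icc 1 N, ‖(τ ω).Θhat i - P.Θ‖ ≤ E) (L : ℝ) :
    μ.real {ω | L ≤ ∑ i ∈ Icc 1 N, ∑ t ∈ Icc 1 T,
      (inner ℝ (P.model ((τ ω).x i t) ((τ ω).Θhat i - P.Θ) ((τ ω).c i)) ((τ ω).w i t)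
        - W ^ 2 * ‖P.model ((τ ω).x i t) ((τ ω).Θhat i - P.Θ) ((τ ω).c i)‖ ^ 2)}
      ≤ Real.exp (-L) := by
  refine hτ.measureReal_ge_le hT le_rfl
    (a := fun i t ω => P.model ((τ ω).x i t) ((τ ω).Θhat i - P.Θ) ((τ ω).c i))
    (A := KY * Kc * E) (fun i hi t ht => ?_) (fun i hi t ht => ?_) L
  · have hle : (i - 1) * T ≤ (i - 1) * T + (t - 1) := Nat.le_add_right _ _
    exact measurable_model_sub hY (hτ.meas_x i hi t ht)
      (fun a b => (hτ.measurable_estimate hlam hY hi a b).mono (ℱ.mono hle) le_rfl)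
      ((hτ.meas_c i hi).mono (ℱ.mono hle) le_rfl) P.Θ
  · filter_upwards [hτ.norm_c, hE] with ω hω h2
    have hKc : 0 ≤ Kc := (norm_nonneg _).trans (hω i hi)
    have hKY' : 0 ≤ KY := (norm_nonneg _).trans (hKY ((τ ω).x i t))
    exact (P.norm_model_le hKY _ _ (hω i hi)).trans (by gcongr; exact h2 i hi)

end Tail

/-! ### A finite grid of directions. -/

section Grid

/-- Grid of matrices with entries `ε k - D`, `0 ≤ k ≤ M`. -/
def gridPoint {p h : ℕ} (ε D : ℝ) {M : ℕ} (k : Fin p → Fin h → Fin (M + 1)) : Mat p h :=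
  Matrix.of fun a b => ε * ((k a b : ℕ) : ℝ) - D

theorem exists_gridPoint_near {p h M : ℕ} {ε D : ℝ} (hε : 0 < ε) (hM : 2 * D ≤ ε * M)
    {X : Mat p h} (hX : ∀ a b, |X a b| ≤ D) :
    ∃ k : Fin p → Fin h → Fin (M + 1), ∀ a b, |(gridPoint ε D k - X) a b| ≤ ε := by
  -- Each entry is rounded down to the grid; `2 D ≤ ε M` keeps the index in range.
  have hn : ∀ a b, ⌊(X a b + D) / ε⌋₊ < M + 1 := by
    intro a b
    have h1 := (abs_le.1 (hX a b)).2
    refine Nat.lt_succ_of_le (Nat.floor_le_of_le ?_)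
    rw [div_le_iff₀ hε]
    linarith
  refine ⟨fun a b => ⟨_, hn a b⟩, fun a b => ?_⟩
  have h0 : 0 ≤ (X a b + D) / ε := div_nonneg (by linarith [(abs_le.1 (hX a b)).1]) hε.le
  have h1 := Nat.floor_le h0
  have h2 := Nat.lt_floor_add_one ((X a b + D) / ε)
  rw [le_div_iff₀ hε] at h1
  rw [div_lt_iff₀ hε] at h2
  rw [abs_le, Matrix.sub_apply]
  simp only [gridPoint, Matrix.of_apply]
  constructor <;> nlinarith

end Grid

end OMAC

namespace OMAC

open Finset

/-! ### Ridge regression error on the good event. -/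

section EstimationError

/-- Passes from a grid direction `G` to a nearby `E`. The scale is negative because a lower bound on
`⟨E, w⟩` is wanted. Its size makes the compensator cost at most `‖G‖² / 2 ≤ 3/4 ‖E‖² + 3/2 η²`,
which leaves a quarter of the energy in the ridge inequality; the `+ 1` covers `W = 0`. -/
theorem two_inner_ge {n : ℕ} {E G w : Vec n} {η W : ℝ} (hη : ‖G - E‖ ≤ η) (hw : ‖w‖ ≤ W) :
    -(8 * (W ^ 2 + 1)) * (inner ℝ (-(1 / (4 * (W ^ 2 + 1))) • G) w
      - W ^ 2 * ‖-(1 / (4 * (W ^ 2 + 1))) • G‖ ^ 2) - 3 / 4 * ‖E‖ ^ 2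
      - (3 / 2 * η ^ 2 + 2 * η * W) ≤ 2 * inner ℝ E w := by
  have hη0 : 0 ≤ η := (norm_nonneg _).trans hη
  have h1 : inner ℝ (G - E) w ≤ η * W :=
    (real_inner_le_norm _ _).trans (mul_le_mul hη hw (norm_nonneg _) hη0)
  rw [inner_sub_left] at h1
  have h2 : ‖G‖ ^ 2 ≤ 3 / 2 * ‖E‖ ^ 2 + 3 * η ^ 2 := by
    have h3 : ‖G‖ ≤ ‖E‖ + η := by
      calc ‖G‖ = ‖E + (G - E)‖ := by congr 1; abel
        _ ≤ _ := (norm_add_le _ _).trans (by gcongr)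
    calc ‖G‖ ^ 2 ≤ (‖E‖ + η) ^ 2 := by gcongr
      _ ≤ _ := by nlinarith [sq_nonneg (‖E‖ - 2 * η)]
  have h4 : -(8 * (W ^ 2 + 1)) * (inner ℝ (-(1 / (4 * (W ^ 2 + 1))) • G) w
      - W ^ 2 * ‖-(1 / (4 * (W ^ 2 + 1))) • G‖ ^ 2)
      = 2 * inner ℝ G w + W ^ 2 / (W ^ 2 + 1) * (1 / 2 * ‖G‖ ^ 2) := by
    rw [real_inner_smul_left, norm_smul, mul_pow, Real.norm_eq_abs, sq_abs]
    field_simp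
    ring
  have h5 : W ^ 2 / (W ^ 2 + 1) * (1 / 2 * ‖G‖ ^ 2) ≤ 1 * (1 / 2 * ‖G‖ ^ 2) := by
    gcongr
    rw [div_le_one (by positivity)]
    linarith
  rw [h4]
  linarith

variable {n m p h : ℕ} {P : Plant n m p h} {τ : Traj n m p h} {N T : ℕ} {lam : ℝ}
  {Θ₁ : Mat p h} {K₂ : Set (Vec h)} {A₂ : Vec h → List (Vec h → ℝ) → Vec h}
  {KΘ KY Kc W : ℝ}

theorem IsRun.norm_error_le (hrun : IsRun P τ N T lam Θ₁ K₂ A₂) (hlam : 0 < lam)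
    (hΘ : ‖P.Θ‖ ≤ KΘ) (hw : ∀ i ∈ Icc 1 N, ∀ t ∈ Icc 1 T, ‖τ.w i t‖ ≤ W)
    (hNT : 1 ≤ N * T) {D₀ : ℝ} (hD : √(KΘ ^ 2 + W ^ 2 / lam) + KΘ ≤ D₀) {i : ℕ}
    (hi : i ∈ Icc 1 N) : ‖τ.Θhat (i + 1) - P.Θ‖ ≤ D₀ * (N * T) := by
  have hNT' : (1 : ℝ) ≤ N * T := by exact_mod_cast hNT
  have hKΘ : 0 ≤ KΘ := (norm_nonneg _).trans hΘ
  have h1 := hrun.norm_sq_estimate_le hw hi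
  -- The comparison gives growth `√(N T)`; the weaker `N T` suffices, since the grid size enters
  -- only through its logarithm.
  have h2 : ‖τ.Θhat (i + 1)‖ ^ 2 ≤ (√(KΘ ^ 2 + W ^ 2 / lam) * (N * T)) ^ 2 := by
    rw [mul_pow, Real.sq_sqrt (by positivity)]
    have h3 : ‖P.Θ‖ ^ 2 ≤ KΘ ^ 2 := by gcongr
    have h4 : ‖τ.Θhat (i + 1)‖ ^ 2 ≤ KΘ ^ 2 + N * T * (W ^ 2 / lam) := by
      have : lam * ‖τ.Θhat (i + 1)‖ ^ 2 ≤ lam * (KΘ ^ 2 + N * T * (W ^ 2 / lam)) := by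
        calc _ ≤ lam * KΘ ^ 2 + N * T * W ^ 2 := by nlinarith
          _ = _ := by field_simp
      exact le_of_mul_le_mul_left this hlam
    have h5 : (1 : ℝ) ≤ (N * T) ^ 2 := one_le_pow₀ hNT'
    have h6 : (N * T : ℝ) ≤ (N * T) ^ 2 := by nlinarith
    have h7 : 0 ≤ W ^ 2 / lam := by positivity
    nlinarith [sq_nonneg KΘ, mul_le_mul_of_nonneg_right h6 h7]
  have h3 : ‖τ.Θhat (i + 1)‖ ≤ √(KΘ ^ 2 + W ^ 2 / lam) * (N * T) :=
    le_of_sq_le_sq h2 (by positivity)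
  calc ‖τ.Θhat (i + 1) - P.Θ‖ ≤ ‖τ.Θhat (i + 1)‖ + ‖P.Θ‖ := norm_sub_le _ _
    _ ≤ √(KΘ ^ 2 + W ^ 2 / lam) * (N * T) + KΘ * (N * T) := by nlinarith
    _ ≤ D₀ * (N * T) := by rw [← add_mul]; gcongr

/-- Ridge regression error, when the noise is controlled in all directions of a grid. -/
theorem IsRun.ridge_error_le (hrun : IsRun P τ N T lam Θ₁ K₂ A₂) (hlam : 0 < lam)
    (hKY : ∀ x, ‖P.Y x‖ ≤ KY) (hΘ : ‖P.Θ‖ ≤ KΘ)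
    (hc : ∀ i ∈ Icc 1 N, ‖τ.c i‖ ≤ Kc)
    (hw : ∀ i ∈ Icc 1 N, ∀ t ∈ Icc 1 T, ‖τ.w i t‖ ≤ W)
    (hNT : 1 ≤ N * T) {D₀ : ℕ} (hD : √(KΘ ^ 2 + W ^ 2 / lam) + KΘ ≤ D₀) {i : ℕ}
    (hi : i ∈ Icc 1 N) {L : ℝ}
    (hgrid : ∀ k : Fin p → Fin h → Fin (2 * D₀ * (N * T) ^ 2 + 1),
      ∑ j ∈ Icc 1 i, ∑ t ∈ Icc 1 T,
        (inner ℝ (-(1 / (4 * (W ^ 2 + 1))) • P.model (τ.x j t)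
            (gridPoint (1 / (N * T)) (D₀ * (N * T)) k) (τ.c j)) (τ.w j t)
          - W ^ 2 * ‖-(1 / (4 * (W ^ 2 + 1))) • P.model (τ.x j t)
            (gridPoint (1 / (N * T)) (D₀ * (N * T)) k) (τ.c j)‖ ^ 2) < L) :
    1 / 4 * ∑ j ∈ Icc 1 i, ∑ t ∈ Icc 1 T,
        ‖P.model (τ.x j t) (τ.Θhat (i + 1) - P.Θ) (τ.c j)‖ ^ 2
      + lam / 2 * ‖τ.Θhat (i + 1) - P.Θ‖ ^ 2
      ≤ 2 * lam * KΘ ^ 2 + 3 / 2 * (KY * Kc * √(p * h)) ^ 2 + 2 * (KY * Kc * √(p * h)) * W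
        + 8 * (W ^ 2 + 1) * L := by
  have hNT' : (1 : ℝ) ≤ N * T := by exact_mod_cast hNT
  have hKΘ : 0 ≤ KΘ := (norm_nonneg _).trans hΘ
  have hT : 1 ∈ Icc 1 T := mem_Icc.2 ⟨le_rfl, Nat.pos_of_mul_pos_left hNT⟩
  have hW : 0 ≤ W := (norm_nonneg _).trans (hw i hi 1 hT)
  have hKc : 0 ≤ Kc := (norm_nonneg _).trans (hc i hi)
  have hKY' : 0 ≤ KY := (norm_nonneg _).trans (hKY 0)
  set e := τ.Θhat (i + 1) - P.Θ with he
  set q := KY * Kc * √(p * h) with hq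
  have hq0 : 0 ≤ q := by positivity
  -- With this mesh, rounding errors of order `ε` over at most `N T` steps add up to a constant.
  set ε : ℝ := 1 / (N * T) with hε
  have hε0 : 0 < ε := by positivity
  have hεNT : (N * T : ℝ) * ε = 1 := mul_one_div_cancel (by positivity)
  have hε1 : ε ≤ 1 := by rw [hε, div_le_one (by positivity)]; exact hNT'
  obtain ⟨k, hk⟩ := exists_gridPoint_near (M := 2 * D₀ * (N * T) ^ 2) (D := D₀ * (N * T)) hε0
    (X := e) (by
      push_cast
      have : ε * (2 * D₀ * (N * T) ^ 2) = 2 * (D₀ * (N * T)) * ((N * T) * ε) := by ring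
      rw [this, hεNT, mul_one])
    (fun a b => (abs_entry_le_norm e a b).trans (hrun.norm_error_le hlam hΘ hw hNT hD hi))
  set X := gridPoint ε (D₀ * (N * T)) k with hX
  have hXe : ‖X - e‖ ≤ √(p * h) * ε := by
    refine le_of_sq_le_sq ?_ (by positivity)
    rw [mul_pow, Real.sq_sqrt (by positivity)]
    exact norm_sq_le_of_entries _ _ hk
  have hmem : ∀ j ∈ Icc 1 i, j ∈ Icc 1 N := fun j hj => by rw [mem_Icc] at *; omega
  have hpt : ∀ j ∈ Icc 1 i, ∀ t ∈ Icc 1 T, _ := fun j hj t ht =>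
    two_inner_ge (E := P.model (τ.x j t) e (τ.c j)) (G := P.model (τ.x j t) X (τ.c j))
      (w := τ.w j t) (η := q * ε) (W := W) (by
        rw [← Plant.model_sub]
        calc _ ≤ KY * Kc * ‖X - e‖ := P.norm_model_le hKY _ _ (hc j (hmem j hj))
          _ ≤ KY * Kc * (√(p * h) * ε) := by gcongr
          _ = q * ε := by rw [hq]; ring) (hw j (hmem j hj) t ht)
  have hsum := sum_le_sum fun j hj => sum_le_sum fun t ht => hpt j hj t ht
  simp only [sum_sub_distrib, ← mul_sum] at hsum
  have hcard : ∑ _j ∈ Icc 1 i, ∑ _t ∈ Icc 1 T, (3 / 2 * (q * ε) ^ 2 + 2 * (q * ε) * W)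
      ≤ 3 / 2 * q ^ 2 + 2 * q * W := by
    have hiN : (i : ℝ) ≤ N := by exact_mod_cast (mem_Icc.1 hi).2
    calc _ = (i * T : ℝ) * (3 / 2 * (q * ε) ^ 2 + 2 * (q * ε) * W) := by
          simp only [sum_const, Nat.card_Icc, Nat.add_sub_cancel, nsmul_eq_mul]
          ring
      _ ≤ (N * T : ℝ) * (3 / 2 * (q * ε) ^ 2 + 2 * (q * ε) * W) := by gcongr
      _ = ((N * T : ℝ) * ε) * (3 / 2 * q ^ 2 * ε + 2 * q * W) := by ring
      _ ≤ 1 * (3 / 2 * q ^ 2 * 1 + 2 * q * W) := by rw [hεNT]; gcongr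
      _ = _ := by ring
  have hg := hgrid k
  simp only [sum_sub_distrib, ← mul_sum] at hg
  have hg' := mul_lt_mul_of_pos_left hg (show 0 < 8 * (W ^ 2 + 1) by positivity)
  have hridge := hrun.ridge_inequality hi
  rw [← he] at hridge
  have hΘ2 : lam * ‖P.Θ‖ ^ 2 ≤ lam * KΘ ^ 2 := by gcongr
  -- The penalty on the estimate becomes one on the error, at the price of a second `lam * KΘ ^ 2`;
  -- it will control the environments before `i₀`.
  have he2 : lam / 2 * ‖e‖ ^ 2 ≤ lam * ‖τ.Θhat (i + 1)‖ ^ 2 + lam * KΘ ^ 2 := by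
    have h1 : ‖e‖ ^ 2 ≤ 2 * ‖τ.Θhat (i + 1)‖ ^ 2 + 2 * KΘ ^ 2 := by
      calc ‖e‖ ^ 2 ≤ (‖τ.Θhat (i + 1)‖ + KΘ) ^ 2 := by
            gcongr
            exact (norm_sub_le _ _).trans (by gcongr)
        _ ≤ _ := by nlinarith [sq_nonneg (‖τ.Θhat (i + 1)‖ - KΘ)]
    nlinarith
  linarith

end EstimationError

/-! ### Logarithm of the number of bad events. -/

section Logarithm

/-- The count is polynomial in `N T`. As `N ≥ 2`, the target logarithm is at least `log 2`, so fixed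
constants are absorbed after division by `log 2`. -/
theorem log_card_le {N T D₀ p h : ℕ} {δ : ℝ} (hN : 2 ≤ N) (hT : 1 ≤ T) (hδ₀ : 0 < δ)
    (hδ₁ : δ < 1) :
    Real.log 2 ≤ Real.log (N * T / δ) ∧
    Real.log ((1 + N * (((2 * D₀ * (N * T) ^ 2 + 1 : ℕ) : ℝ) ^ h) ^ p) / δ)
      ≤ (2 + h * p * (Real.log (2 * D₀ + 1) / Real.log 2 + 2)) * Real.log (N * T / δ) := by
  have hN' : (2 : ℝ) ≤ N := by exact_mod_cast hN
  have hT' : (1 : ℝ) ≤ T := by exact_mod_cast hT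
  have hNT : (2 : ℝ) ≤ N * T := by nlinarith
  have hδ : (N * T : ℝ) ≤ N * T / δ := by
    rw [le_div_iff₀ hδ₀]; nlinarith
  have hNδ : (N / δ : ℝ) ≤ N * T / δ := by
    gcongr; nlinarith
  have l2 : 0 < Real.log 2 := Real.log_pos (by norm_num)
  set Λ := Real.log (N * T / δ) with hΛ
  have h1 : Real.log 2 ≤ Λ := Real.log_le_log (by norm_num) (hNT.trans hδ)
  refine ⟨h1, ?_⟩
  have h2 : Real.log (N * T) ≤ Λ := Real.log_le_log (by positivity) hδ
  have h3 : Real.log (N / δ) ≤ Λ := Real.log_le_log (by positivity) hNδ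
  have hM : (((2 * D₀ * (N * T) ^ 2 + 1 : ℕ) : ℝ)) ≤ (2 * D₀ + 1) * (N * T) ^ 2 := by
    push_cast
    have : (1 : ℝ) ≤ (N * T) ^ 2 := one_le_pow₀ (by linarith)
    nlinarith
  set Q : ℝ := (((2 * D₀ + 1) * (N * T) ^ 2) ^ h) ^ p with hQ
  have hQ1 : 1 ≤ Q := by
    refine one_le_pow₀ (one_le_pow₀ ?_)
    have h4 : (1 : ℝ) ≤ (N * T) ^ 2 := one_le_pow₀ (by linarith)
    have h5 : (1 : ℝ) ≤ 2 * D₀ + 1 := by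
      have : (0 : ℝ) ≤ D₀ := by positivity
      linarith
    nlinarith
  have h6 : (1 + N * (((2 * D₀ * (N * T) ^ 2 + 1 : ℕ) : ℝ) ^ h) ^ p) / δ ≤ 2 * (N / δ) * Q := by
    have : (((2 * D₀ * (N * T) ^ 2 + 1 : ℕ) : ℝ) ^ h) ^ p ≤ Q := by rw [hQ]; gcongr
    rw [show 2 * (N / δ) * Q = (2 * N * Q) / δ by ring]
    gcongr
    nlinarith
  have h7 : Real.log Q
      = h * p * (Real.log (2 * D₀ + 1) + 2 * Real.log (N * T)) := by
    rw [hQ, Real.log_pow, Real.log_pow, Real.log_mul (by positivity) (by positivity),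
      Real.log_pow]
    push_cast; ring
  have h8 : Real.log (2 * D₀ + 1) ≤ Real.log (2 * D₀ + 1) / Real.log 2 * Λ := by
    have : 0 ≤ Real.log (2 * (D₀ : ℝ) + 1) :=
      Real.log_nonneg (by have : (0 : ℝ) ≤ D₀ := by positivity
                          linarith)
    rw [div_mul_eq_mul_div, le_div_iff₀ l2]
    gcongr
  calc _ ≤ Real.log (2 * (N / δ) * Q) := Real.log_le_log (by positivity) h6
    _ = Real.log 2 + Real.log (N / δ)
        + h * p * (Real.log (2 * D₀ + 1) + 2 * Real.log (N * T)) := by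
        rw [Real.log_mul (by positivity) (by positivity), Real.log_mul (by norm_num)
          (by positivity), h7]
    _ ≤ Λ + Λ + h * p * (Real.log (2 * D₀ + 1) / Real.log 2 * Λ + 2 * Λ) := by gcongr
    _ = _ := by ring

end Logarithm

end OMAC

namespace OMAC

open Finset MeasureTheory

/-! ### Sums of the inverse diversity rates. -/

section Rates

theorem sum_Icc_one_eq_add_sum_Icc {N : ℕ} (hN : 1 ≤ N) (f : ℕ → ℝ) :
    ∑ i ∈ Icc 1 N, f i = f 1 + ∑ j ∈ Icc 1 (N - 1), f (j + 1) := by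
  obtain ⟨N, rfl⟩ : ∃ M, N = M + 1 := ⟨N - 1, by omega⟩
  rw [Nat.add_sub_cancel]
  induction N with
  | zero => simp
  | succ N ih => rw [sum_Icc_succ_top (by omega), ih (by omega), sum_Icc_succ_top (by omega)]; ring

theorem sum_Icc_inv_le {N : ℕ} (hN : 2 ≤ N) :
    ∑ j ∈ Icc 1 (N - 1), 1 / (j : ℝ) ≤ (1 + 1 / Real.log 2) * Real.log N := by
  have l2 : 0 < Real.log 2 := Real.log_pos (by norm_num)
  have h1 := harmonic_le_one_add_log N
  have h2 : Real.log 2 ≤ Real.log N := Real.log_le_log (by norm_num) (by exact_mod_cast hN)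
  have h3 : ∑ j ∈ Icc 1 (N - 1), 1 / (j : ℝ) ≤ (harmonic N : ℝ) := by
    rw [harmonic_eq_sum_Icc]
    push_cast
    simp only [one_div]
    exact sum_le_sum_of_subset_of_nonneg (Icc_subset_Icc_right (by omega))
      fun _ _ _ => by positivity
  have h4 : 1 ≤ 1 / Real.log 2 * Real.log N := by
    rw [one_div_mul_eq_div, le_div_iff₀ l2]; linarith
  linarith

theorem sum_Icc_inv_sqrt_le (N : ℕ) : ∑ j ∈ Icc 1 (N - 1), 1 / √(j : ℝ) ≤ 2 * √N := by
  have key : ∀ M : ℕ, ∑ j ∈ Icc 1 M, 1 / √(j : ℝ) ≤ 2 * √M := by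
    intro M
    induction M with
    | zero => simp
    | succ M ih =>
      rw [sum_Icc_succ_top (by omega)]
      have hpos : 0 < √((M + 1 : ℕ) : ℝ) := Real.sqrt_pos.2 (by positivity)
      have h1 : √((M + 1 : ℕ) : ℝ) ^ 2 = M + 1 := by rw [Real.sq_sqrt (by positivity)]; simp
      have h2 : √(M : ℝ) ^ 2 = M := Real.sq_sqrt (by positivity)
      have h3 : 1 / √((M + 1 : ℕ) : ℝ) ≤ 2 * √((M + 1 : ℕ) : ℝ) - 2 * √(M : ℝ) := by
        rw [div_le_iff₀ hpos]
        nlinarith [sq_nonneg (√((M + 1 : ℕ) : ℝ) - √(M : ℝ))]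
      linarith
  refine (key (N - 1)).trans ?_
  gcongr
  omega

end Rates

/-! ### From diversity to the estimation error and the inner cost. -/

section Deterministic

variable {n m p h : ℕ} {P : Plant n m p h} {τ : Traj n m p h} {N T : ℕ} {lam : ℝ}
  {Θ₁ : Mat p h} {K₂ : Set (Vec h)} {A₂ : Vec h → List (Vec h → ℝ) → Vec h}
  {KΘ KY Kc W : ℝ}

/-- A bound on the ridge objective turns diversity into a bound on the estimation error. -/
theorem norm_sq_le_of_diverse {κ : ℝ} {i₀ : ℕ} {d : ℕ → ℝ} (hlam : 0 < lam) (hκ : 0 < κ)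
    (hd : ∀ j, 1 ≤ j → 0 < d j ∧ d j ≤ j) (hdiv : IsDiverse P τ N T κ i₀ d) {j : ℕ}
    (hj : j ∈ Icc 1 N) {X : Mat p h} {A : ℝ}
    (hA : 1 / 4 * ∑ i ∈ Icc 1 j, ∑ t ∈ Icc 1 T, ‖P.model (τ.x i t) X (τ.c i)‖ ^ 2
      + lam / 2 * ‖X‖ ^ 2 ≤ A) : ‖X‖ ^ 2 ≤ A * (4 / κ + 2 * i₀ / lam) * (1 / d j) := by
  obtain ⟨hd0, hdj⟩ := hd j (mem_Icc.1 hj).1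
  have hQ : 0 ≤ ∑ i ∈ Icc 1 j, ∑ t ∈ Icc 1 T, ‖P.model (τ.x i t) X (τ.c i)‖ ^ 2 := by positivity
  have hX : 0 ≤ lam / 2 * ‖X‖ ^ 2 := by positivity
  have hA0 : 0 ≤ A := by linarith
  rw [mul_one_div, le_div_iff₀ hd0]
  have p1 : 0 ≤ A * (4 / κ) := by positivity
  have p2 : 0 ≤ A * (2 * i₀ / lam) := by positivity
  -- From `i₀` on the eigenvalue bound applies; before it, the ridge penalty bounds `‖X‖` and `d j ≤
  -- i₀`.
  rcases le_or_gt i₀ j with hij | hij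
  · have h1 := hdiv j hj hij
    have h2 : κ * d j * ‖X‖ ^ 2 ≤ 4 * A := by
      have := minEigenvalue_gram_mul_le P τ T j X
      have := mul_le_mul_of_nonneg_right h1 (sq_nonneg ‖X‖)
      linarith
    have h3 : ‖X‖ ^ 2 * d j ≤ A * (4 / κ) := by
      rw [show A * (4 / κ) = 4 * A / κ by ring, le_div_iff₀ hκ]
      linarith
    linarith
  · have h2 : lam / 2 * ‖X‖ ^ 2 ≤ A := by linarith
    have h3 : d j ≤ i₀ := hdj.trans (by exact_mod_cast hij.le)
    have h4 : ‖X‖ ^ 2 * d j ≤ A * (2 * i₀ / lam) := by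
      rw [show A * (2 * i₀ / lam) = 2 * A * i₀ / lam by ring, le_div_iff₀ hlam]
      calc ‖X‖ ^ 2 * d j * lam ≤ ‖X‖ ^ 2 * i₀ * lam := by gcongr
        _ = 2 * (lam / 2 * ‖X‖ ^ 2) * i₀ := by ring
        _ ≤ 2 * A * i₀ := by gcongr
    linarith

/-- Average inner cost at the true environmental conditions. -/
theorem IsRun.sum_innerCost_true_le (hrun : IsRun P τ N T lam Θ₁ K₂ A₂)
    (hKY : ∀ x, ‖P.Y x‖ ≤ KY) (hc : ∀ i ∈ Icc 1 N, ‖τ.c i‖ ≤ Kc)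
    (hw : ∀ i ∈ Icc 1 N, ∀ t ∈ Icc 1 T, ‖τ.w i t‖ ≤ W) {L : ℝ}
    (hmain : ∑ i ∈ Icc 1 N, ∑ t ∈ Icc 1 T,
      (inner ℝ (P.model (τ.x i t) (τ.Θhat i - P.Θ) (τ.c i)) (τ.w i t)
        - W ^ 2 * ‖P.model (τ.x i t) (τ.Θhat i - P.Θ) (τ.c i)‖ ^ 2) < L) :
    ∑ i ∈ Icc 1 N, ∑ t ∈ Icc 1 T, innerCost P τ i t (τ.c i)
      ≤ N * T * W ^ 2 + 2 * L
        + (1 + 2 * W ^ 2) * (T * (KY * Kc) ^ 2 * ∑ i ∈ Icc 1 N, ‖τ.Θhat i - P.Θ‖ ^ 2) := by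
  -- The compensator is subtracted and added back to form the bracket of the tail bound, whence the
  -- factor `1 + 2 * W ^ 2`.
  have h1 : ∑ i ∈ Icc 1 N, ∑ t ∈ Icc 1 T, innerCost P τ i t (τ.c i)
      = ∑ i ∈ Icc 1 N, ∑ t ∈ Icc 1 T, (‖τ.w i t‖ ^ 2
        + 2 * (inner ℝ (P.model (τ.x i t) (τ.Θhat i - P.Θ) (τ.c i)) (τ.w i t)
        - W ^ 2 * ‖P.model (τ.x i t) (τ.Θhat i - P.Θ) (τ.c i)‖ ^ 2)
        + (1 + 2 * W ^ 2) * ‖P.model (τ.x i t) (τ.Θhat i - P.Θ) (τ.c i)‖ ^ 2) := by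
    refine sum_congr rfl fun i hi => sum_congr rfl fun t ht => ?_
    rw [innerCost, hrun.loss_eq hi ht, norm_add_sq_real]
    ring
  have h2 : ∑ i ∈ Icc 1 N, ∑ t ∈ Icc 1 T, ‖τ.w i t‖ ^ 2 ≤ N * T * W ^ 2 := by
    calc _ ≤ ∑ _i ∈ Icc 1 N, ∑ _t ∈ Icc 1 T, W ^ 2 :=
          sum_le_sum fun i hi => sum_le_sum fun t ht =>
            pow_le_pow_left₀ (norm_nonneg _) (hw i hi t ht) 2
      _ = _ := by simp [mul_assoc]
  have h3 : ∑ i ∈ Icc 1 N, ∑ t ∈ Icc 1 T,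
      ‖P.model (τ.x i t) (τ.Θhat i - P.Θ) (τ.c i)‖ ^ 2
      ≤ T * (KY * Kc) ^ 2 * ∑ i ∈ Icc 1 N, ‖τ.Θhat i - P.Θ‖ ^ 2 := by
    rw [mul_sum]
    refine sum_le_sum fun i hi => ?_
    calc _ ≤ ∑ _t ∈ Icc 1 T, (KY * Kc * ‖τ.Θhat i - P.Θ‖) ^ 2 :=
          sum_le_sum fun t ht => pow_le_pow_left₀ (norm_nonneg _)
            (P.norm_model_le hKY _ _ (hc i hi)) 2
      _ = _ := by simp; ring
  have h4 := mul_le_mul_of_nonneg_left h3 (show 0 ≤ 1 + 2 * W ^ 2 by positivity)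
  rw [h1]
  simp only [sum_add_distrib, ← mul_sum]
  linarith

end Deterministic

/-! ### Union bound and assembly. -/

section Main

/-- Only monotonicity and subadditivity are used, so neither set need be measurable. -/
theorem ofReal_le_measure_of_compl {Ω : Type*} {m₀ : MeasurableSpace Ω} {μ : Measure Ω}
    [IsProbabilityMeasure μ] {B G : Set Ω} {δ : ℝ} (hδ : 0 ≤ δ) (hB : μ.real B ≤ δ)
    (hG : ∀ᵐ ω ∂μ, ω ∉ B → ω ∈ G) : ENNReal.ofReal (1 - δ) ≤ μ G := by
  have h1 : μ Bᶜ ≤ μ G := measure_mono_ae hG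
  have h2 : (1 : ENNReal) ≤ μ B + μ Bᶜ := by
    rw [← measure_univ (μ := μ), ← Set.union_compl_self B]
    exact measure_union_le _ _
  have h3 : μ B ≤ ENNReal.ofReal δ := by
    rw [← ofReal_measureReal]
    exact ENNReal.ofReal_le_ofReal hB
  rw [ENNReal.ofReal_sub _ hδ, ENNReal.ofReal_one]
  refine tsub_le_iff_left.2 (h2.trans ?_)
  gcongr

/-- The error bound for a general diversity rate `d`, with `H N` the order of
`∑_{j < N} 1 / d j`. -/
theorem exists_ace_bound (n m p h : ℕ) (β γ ρ W R KΘ Kc KY lam κ : ℝ) (i₀ : ℕ)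
    (Θ₁ : Mat p h) (r : ℕ → ℝ) (hγ : 0 ≤ γ) (hρ₀ : 0 ≤ ρ) (hρ₁ : ρ < 1)
    (hlam : 0 < lam) (hκ : 0 < κ) (d H : ℕ → ℝ) (a : ℝ)
    (hd : ∀ j, 1 ≤ j → 0 < d j ∧ d j ≤ j)
    (hH₁ : ∀ N, 2 ≤ N → 1 ≤ a * H N)
    (hH₂ : ∀ N, 2 ≤ N → ∑ j ∈ Icc 1 (N - 1), 1 / d j ≤ a * H N) :
    ∃ C : ℝ, ∀ (N T : ℕ) (δ : ℝ), 2 ≤ N → 1 ≤ T → 0 < δ → δ < 1 →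
      ∀ (P : Plant n m p h) (K₂ : Set (Vec h))
        (A₂ : Vec h → List (Vec h → ℝ) → Vec h)
        (Ω : Type*) (m₀ : MeasurableSpace Ω) (μ : Measure Ω)
        (ℱ : Filtration ℕ m₀) (τ : Ω → Traj n m p h),
        IsProbabilityMeasure μ →
        P.IsAdmissible β γ ρ KΘ KY →
        IsRandomRun μ ℱ P τ N T lam Θ₁ K₂ A₂ Kc W R →
        (∀ᵐ ω ∂μ, innerRegret P (τ ω) K₂ N T ≤ N * r T) →
        (∀ᵐ ω ∂μ, IsDiverse P (τ ω) N T κ i₀ d) →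
        ENNReal.ofReal (1 - δ) ≤ μ {ω | ace (τ ω) N T ≤
          γ / (1 - ρ) * Real.sqrt (W ^ 2 + r T / T
            + C * (Real.log (N * T / δ) * (H N / N)))} := by
  obtain ⟨D₀, hD₀⟩ := exists_nat_ge (√(KΘ ^ 2 + W ^ 2 / lam) + KΘ)
  have l2 : 0 < Real.log 2 := Real.log_pos (by norm_num)
  set CL : ℝ := 2 + h * p * (Real.log (2 * D₀ + 1) / Real.log 2 + 2) with hCL
  set c₀ : ℝ := 2 * lam * KΘ ^ 2 + 3 / 2 * (KY * Kc * √(p * h)) ^ 2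
    + 2 * (KY * Kc * √(p * h)) * W with hc₀
  -- Division by `log 2` turns fixed terms into multiples of `Λ ≥ log 2`. The first summand of `C₂`
  -- pays for the initial estimate, which no regression has improved.
  set C₁ : ℝ := |c₀| / Real.log 2 + 8 * (W ^ 2 + 1) * CL with hC₁
  set C₂ : ℝ := (‖Θ₁‖ + KΘ) ^ 2 / Real.log 2 + C₁ * (4 / κ + 2 * i₀ / lam) with hC₂
  have hCL0 : 0 ≤ CL := by
    have : 0 ≤ Real.log (2 * (D₀ : ℝ) + 1) :=
      Real.log_nonneg (by have : (0 : ℝ) ≤ D₀ := by positivity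
                          linarith)
    positivity
  have hC₁0 : 0 ≤ C₁ := by positivity
  have hC₂0 : 0 ≤ C₂ := by positivity
  refine ⟨a * (2 * CL + (1 + 2 * W ^ 2) * (KY * Kc) ^ 2 * C₂), ?_⟩
  intro N T δ hN hT hδ₀ hδ₁ P K₂ A₂ Ω m₀ μ ℱ τ hμ hP hτ hreg hdiv
  obtain ⟨hΛ, hlog⟩ := log_card_le (D₀ := D₀) (p := p) (h := h) hN hT hδ₀ hδ₁
  set Λ : ℝ := Real.log (N * T / δ) with hΛdef
  set M : ℕ := 2 * D₀ * (N * T) ^ 2 with hM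
  -- One bad event for the cross term, and one for each grid point at the end of each environment,
  -- all of probability at most `exp (-L)`, add up to `δ`.
  set L : ℝ := Real.log ((1 + N * (((M + 1 : ℕ) : ℝ) ^ h) ^ p) / δ) with hL
  have hΛ0 : 0 < Λ := l2.trans_le hΛ
  have hNT : 1 ≤ N * T := Nat.mul_pos (by omega) hT
  have hNR : (2 : ℝ) ≤ N := by exact_mod_cast hN
  have hTR : (1 : ℝ) ≤ T := by exact_mod_cast hT
  have hKΘ : 0 ≤ KΘ := (norm_nonneg _).trans hP.norm_Θ
  have herr₁ : ∀ ω, ‖(τ ω).Θhat 1 - P.Θ‖ ≤ ‖Θ₁‖ + KΘ := fun ω => by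
    rw [(hτ.run ω).outer_init]
    exact (norm_sub_le _ _).trans (by gcongr; exact hP.norm_Θ)
  -- Only finiteness matters here: the bound makes the predictable integrand bounded and is lost in
  -- the tail estimate.
  have herr : ∀ᵐ ω ∂μ, ∀ i ∈ Icc 1 N,
      ‖(τ ω).Θhat i - P.Θ‖ ≤ (‖Θ₁‖ + KΘ) + |(D₀ * (N * T) : ℝ)| := by
    filter_upwards [hτ.norm_w] with ω hw i hi
    rw [mem_Icc] at hi
    rcases Nat.eq_or_lt_of_le hi.1 with rfl | h1
    · exact (herr₁ ω).trans (le_add_of_nonneg_right (abs_nonneg _))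
    · obtain ⟨j, rfl⟩ : ∃ j, i = j + 1 := ⟨i - 1, by omega⟩
      have := (hτ.run ω).norm_error_le hlam hP.norm_Θ hw hNT hD₀
        (mem_Icc.2 ⟨by omega, by omega⟩ : j ∈ Icc 1 N)
      exact (this.trans (le_abs_self _)).trans (le_add_of_nonneg_left (by positivity))
  set B₀ : Set Ω := {ω | L ≤ ∑ i ∈ Icc 1 N, ∑ t ∈ Icc 1 T,
      (inner ℝ (P.model ((τ ω).x i t) ((τ ω).Θhat i - P.Θ) ((τ ω).c i)) ((τ ω).w i t)
        - W ^ 2 * ‖P.model ((τ ω).x i t) ((τ ω).Θhat i - P.Θ) ((τ ω).c i)‖ ^ 2)} with hB₀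
  set s : ℝ := -(1 / (4 * (W ^ 2 + 1))) with hs
  set B₁ : ℕ × (Fin p → Fin h → Fin (M + 1)) → Set Ω := fun q =>
    {ω | L ≤ ∑ j ∈ Icc 1 q.1, ∑ t ∈ Icc 1 T,
      (inner ℝ (s • P.model ((τ ω).x j t)
          (gridPoint (1 / (N * T)) (D₀ * (N * T)) q.2) ((τ ω).c j)) ((τ ω).w j t)
        - W ^ 2 * ‖s • P.model ((τ ω).x j t)
          (gridPoint (1 / (N * T)) (D₀ * (N * T)) q.2) ((τ ω).c j)‖ ^ 2)} with hB₁
  have hexp : Real.exp (-L) * (1 + N * (((M + 1 : ℕ) : ℝ) ^ h) ^ p) = δ := by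
    rw [Real.exp_neg, hL, Real.exp_log (by positivity)]
    field_simp
  have hBad : μ.real (B₀ ∪ ⋃ q ∈ Icc 1 N ×ˢ (univ : Finset (Fin p → Fin h → Fin (M + 1))), B₁ q)
      ≤ δ := by
    calc _ ≤ μ.real B₀
          + μ.real (⋃ q ∈ Icc 1 N ×ˢ (univ : Finset (Fin p → Fin h → Fin (M + 1))), B₁ q) :=
          measureReal_union_le _ _
      _ ≤ Real.exp (-L)
          + ∑ q ∈ Icc 1 N ×ˢ (univ : Finset (Fin p → Fin h → Fin (M + 1))), μ.real (B₁ q) := by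
          gcongr
          · exact hτ.measureReal_estimate_ge_le hT hlam hP.meas_Y hP.norm_Y herr L
          · exact measureReal_biUnion_finset_le _ _
      _ ≤ Real.exp (-L)
          + ∑ _q ∈ Icc 1 N ×ˢ (univ : Finset (Fin p → Fin h → Fin (M + 1))), Real.exp (-L) := by
          gcongr with q hq
          exact hτ.measureReal_direction_ge_le hT hP.meas_Y hP.norm_Y
            (mem_Icc.1 (mem_product.1 hq).1).2 s _ L
      _ = Real.exp (-L) * (1 + N * (((M + 1 : ℕ) : ℝ) ^ h) ^ p) := by
          simp only [sum_const, card_product, Nat.card_Icc, Nat.add_sub_cancel, card_univ,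
            Fintype.card_fun, Fintype.card_fin, nsmul_eq_mul]
          push_cast
          ring
      _ = δ := hexp
  refine ofReal_le_measure_of_compl hδ₀.le hBad ?_
  filter_upwards [hreg, hdiv, hτ.mem_c, hτ.norm_c, hτ.norm_w] with ω hreg hdiv hmem hc hw hω
  have hmain : ω ∉ B₀ := fun hle => hω (Or.inl hle)
  have hgrid : ∀ i ∈ Icc 1 N, ∀ k, ω ∉ B₁ (i, k) := fun i hi k hle =>
    hω (Or.inr (Set.mem_biUnion (mem_coe.2 (mem_product.2 ⟨hi, mem_univ k⟩)) hle))
  simp only [hB₀, hB₁, Set.mem_ofPred_eq, not_le] at hmain hgrid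
  have hrun := hτ.run ω
  have hstep : ∀ j ∈ Icc 1 (N - 1), ‖(τ ω).Θhat (j + 1) - P.Θ‖ ^ 2
      ≤ C₁ * Λ * (4 / κ + 2 * i₀ / lam) * (1 / d j) := by
    intro j hj
    have hjN : j ∈ Icc 1 N := by rw [mem_Icc] at *; omega
    refine norm_sq_le_of_diverse hlam hκ hd hdiv hjN ?_
    refine (hrun.ridge_error_le hlam hP.norm_Y hP.norm_Θ hc hw hNT hD₀ hjN
      (hgrid j hjN)).trans ?_
    rw [← hc₀, hC₁, add_mul]
    have h1 : c₀ ≤ |c₀| / Real.log 2 * Λ := by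
      refine (le_abs_self _).trans ?_
      rw [div_mul_eq_mul_div, le_div_iff₀ l2]
      gcongr
    have h2 : 8 * (W ^ 2 + 1) * L ≤ 8 * (W ^ 2 + 1) * (CL * Λ) := by gcongr
    linarith
  -- This brings the contributions of the first environment and of the cross term to the common
  -- order `Λ * H N`.
  have hΛH : Λ ≤ Λ * (a * H N) := le_mul_of_one_le_right hΛ0.le (hH₁ N hN)
  have hS : ∑ i ∈ Icc 1 N, ‖(τ ω).Θhat i - P.Θ‖ ^ 2 ≤ C₂ * (Λ * (a * H N)) := by
    rw [sum_Icc_one_eq_add_sum_Icc (by omega)]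
    have h1 : ‖(τ ω).Θhat 1 - P.Θ‖ ^ 2
        ≤ (‖Θ₁‖ + KΘ) ^ 2 / Real.log 2 * (Λ * (a * H N)) := by
      calc ‖(τ ω).Θhat 1 - P.Θ‖ ^ 2 ≤ (‖Θ₁‖ + KΘ) ^ 2 := by
            gcongr
            exact herr₁ ω
        _ = (‖Θ₁‖ + KΘ) ^ 2 / Real.log 2 * Real.log 2 := by field_simp
        _ ≤ _ := by
            gcongr
            exact hΛ.trans hΛH
    have h2 : ∑ j ∈ Icc 1 (N - 1), ‖(τ ω).Θhat (j + 1) - P.Θ‖ ^ 2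
        ≤ C₁ * (4 / κ + 2 * i₀ / lam) * (Λ * (a * H N)) := by
      calc _ ≤ ∑ j ∈ Icc 1 (N - 1), C₁ * Λ * (4 / κ + 2 * i₀ / lam) * (1 / d j) :=
            sum_le_sum hstep
        _ = C₁ * Λ * (4 / κ + 2 * i₀ / lam) * ∑ j ∈ Icc 1 (N - 1), 1 / d j := by
            rw [mul_sum]
        _ ≤ C₁ * Λ * (4 / κ + 2 * i₀ / lam) * (a * H N) := by
            gcongr
            exact hH₂ N hN
        _ = _ := by ring
    rw [hC₂, add_mul]
    linarith
  have htrue := hrun.sum_innerCost_true_le hP.norm_Y hc hw hmain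
  have hcost := sum_innerCost_le (P := P) (T := T) hmem
  have hLT : L ≤ CL * (T * (Λ * (a * H N))) := by
    refine hlog.trans ?_
    gcongr
    exact hΛH.trans (le_mul_of_one_le_left (hΛ0.le.trans hΛH) hTR)
  refine (hrun.ace_le_sqrt hγ hρ₀ hρ₁ hP.full_actuation hP.eiss).trans ?_
  have hρ : 0 ≤ γ / (1 - ρ) := div_nonneg hγ (by linarith)
  refine mul_le_mul_of_nonneg_left (Real.sqrt_le_sqrt ?_) hρ
  rw [one_div_mul_eq_div, div_le_iff₀ (by positivity)]
  have hS' : (1 + 2 * W ^ 2) * (T * (KY * Kc) ^ 2 * ∑ i ∈ Icc 1 N, ‖(τ ω).Θhat i - P.Θ‖ ^ 2)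
      ≤ (1 + 2 * W ^ 2) * (T * (KY * Kc) ^ 2 * (C₂ * (Λ * (a * H N)))) := by gcongr
  calc _ ≤ N * r T + (N * T * W ^ 2 + 2 * (CL * (T * (Λ * (a * H N))))
        + (1 + 2 * W ^ 2) * (T * (KY * Kc) ^ 2 * (C₂ * (Λ * (a * H N))))) := by linarith
    _ = _ := by field_simp; ring

end Main

end OMAC

/-- The functions and constants hidden in `o(T)`, `O(·)` (here `e` and `C`) depend only on the
dimensions, on the constants of the assumptions, on the ridge parameter, on the initial
estimate `Θ₁` and on the regret rate `r` of the inner adapter. -/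
theorem theorem6 (n m p h : ℕ) (β γ ρ W R KΘ Kc KY lam κ : ℝ) (i₀ : ℕ)
    (Θ₁ : OMAC.Mat p h) (r : ℕ → ℝ)
    (hβ : 0 ≤ β) (hγ : 0 ≤ γ) (hρ₀ : 0 ≤ ρ) (hρ₁ : ρ < 1) (hR : 0 ≤ R)
    (hlam : 0 < lam) (hκ : 0 < κ)
    (hr : Asymptotics.IsLittleO Filter.atTop r (fun T : ℕ => (T : ℝ))) :
    (∃ (e : ℕ → ℝ) (C : ℝ),
      Asymptotics.IsLittleO Filter.atTop e (fun T : ℕ => (T : ℝ)) ∧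
      ∀ (N T : ℕ) (δ : ℝ), 2 ≤ N → 1 ≤ T → 0 < δ → δ < 1 →
      ∀ (P : OMAC.Plant n m p h) (K₂ : Set (OMAC.Vec h))
        (A₂ : OMAC.Vec h → List (OMAC.Vec h → ℝ) → OMAC.Vec h)
        (Ω : Type*) (m₀ : MeasurableSpace Ω) (μ : MeasureTheory.Measure Ω)
        (ℱ : MeasureTheory.Filtration ℕ m₀) (τ : Ω → OMAC.Traj n m p h),
        MeasureTheory.IsProbabilityMeasure μ →
        P.IsAdmissible β γ ρ KΘ KY →
        Convex ℝ K₂ →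
        OMAC.IsRandomRun μ ℱ P τ N T lam Θ₁ K₂ A₂ Kc W R →
        (∀ᵐ ω ∂μ, OMAC.innerRegret P (τ ω) K₂ N T ≤ N * r T) →
        (∀ᵐ ω ∂μ, OMAC.IsDiverse P (τ ω) N T κ i₀ (fun i => (i : ℝ))) →
        ENNReal.ofReal (1 - δ) ≤ μ {ω | OMAC.ace (τ ω) N T ≤
          γ / (1 - ρ) * Real.sqrt (W ^ 2 + e T / T
            + C * (Real.log (N * T / δ) * Real.log N / N))}) ∧
    (∃ (e : ℕ → ℝ) (C : ℝ),
      Asymptotics.IsLittleO Filter.atTop e (fun T : ℕ => (T : ℝ)) ∧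
      ∀ (N T : ℕ) (δ : ℝ), 2 ≤ N → 1 ≤ T → 0 < δ → δ < 1 →
      ∀ (P : OMAC.Plant n m p h) (K₂ : Set (OMAC.Vec h))
        (A₂ : OMAC.Vec h → List (OMAC.Vec h → ℝ) → OMAC.Vec h)
        (Ω : Type*) (m₀ : MeasurableSpace Ω) (μ : MeasureTheory.Measure Ω)
        (ℱ : MeasureTheory.Filtration ℕ m₀) (τ : Ω → OMAC.Traj n m p h),
        MeasureTheory.IsProbabilityMeasure μ →
        P.IsAdmissible β γ ρ KΘ KY →
        Convex ℝ K₂ →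
        OMAC.IsRandomRun μ ℱ P τ N T lam Θ₁ K₂ A₂ Kc W R →
        (∀ᵐ ω ∂μ, OMAC.innerRegret P (τ ω) K₂ N T ≤ N * r T) →
        (∀ᵐ ω ∂μ, OMAC.IsDiverse P (τ ω) N T κ i₀ (fun i => Real.sqrt i)) →
        ENNReal.ofReal (1 - δ) ≤ μ {ω | OMAC.ace (τ ω) N T ≤
          γ / (1 - ρ) * Real.sqrt (W ^ 2 + e T / T
            + C * (Real.log (N * T / δ) / Real.sqrt N))}) := by
  have l2 : 0 < Real.log 2 := Real.log_pos (by norm_num)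
  constructor
  · obtain ⟨C, hC⟩ := OMAC.exists_ace_bound n m p h β γ ρ W R KΘ Kc KY lam κ i₀ Θ₁ r hγ hρ₀ hρ₁
      hlam hκ (fun i => (i : ℝ)) (fun N => Real.log N) (1 + 1 / Real.log 2)
      (fun j hj => ⟨by exact_mod_cast hj, le_rfl⟩)
      (fun N hN => by
        have h2 : Real.log 2 ≤ Real.log N := Real.log_le_log (by norm_num) (by exact_mod_cast hN)
        calc (1 : ℝ) = 1 / Real.log 2 * Real.log 2 := by field_simp
          _ ≤ (1 + 1 / Real.log 2) * Real.log N := by gcongr; linarith)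
      (fun N hN => OMAC.sum_Icc_inv_le hN)
    -- The inner regret is the only source of the `o(T)` term, so `r` itself is the witness.
    refine ⟨r, C, hr, fun N T δ hN hT hδ₀ hδ₁ P K₂ A₂ Ω m₀ μ ℱ τ hμ hP _ hτ hreg hdiv => ?_⟩
    have := hC N T δ hN hT hδ₀ hδ₁ P K₂ A₂ Ω m₀ μ ℱ τ hμ hP hτ hreg hdiv
    simpa only [mul_div_assoc] using this
  · obtain ⟨C, hC⟩ := OMAC.exists_ace_bound n m p h β γ ρ W R KΘ Kc KY lam κ i₀ Θ₁ r hγ hρ₀ hρ₁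
      hlam hκ (fun i => Real.sqrt i) (fun N => Real.sqrt N) 2
      (fun j hj => by
        have hj' : (1 : ℝ) ≤ j := by exact_mod_cast hj
        exact ⟨Real.sqrt_pos.2 (by linarith), Real.sqrt_le_iff.2 ⟨by linarith, by nlinarith⟩⟩)
      (fun N hN => by
        have hN' : (1 : ℝ) ≤ N := by exact_mod_cast (by omega : 1 ≤ N)
        have := Real.one_le_sqrt.2 hN'
        linarith)
      (fun N _ => OMAC.sum_Icc_inv_sqrt_le N)
    refine ⟨r, C, hr, fun N T δ hN hT hδ₀ hδ₁ P K₂ A₂ Ω m₀ μ ℱ τ hμ hP _ hτ hreg hdiv => ?_⟩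
    have := hC N T δ hN hT hδ₀ hδ₁ P K₂ A₂ Ω m₀ μ ℱ τ hμ hP hτ hreg hdiv
    simpa only [Real.sqrt_div_self, ← div_eq_mul_inv] using this
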